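/- Let $G$ be a finite plane bipartite graph (simple, not necessarily connected) with a perfect matching, different from $K_2$. A finite face of $G$ is a bounded connected component of the complement of $G$ in the plane; its periphery is its boundary. For a perfect matching $M$, a finite face is $M$-resonant if its periphery is an $M$-alternating cycle. A set $S$ of finite faces is a resonant set if its faces are pairwise vertex disjoint and there is a perfect matching $M$ of $G$ such that every face in $S$ is $M$-resonant; a resonant set $S$ is canonical if $G-S$ (the induced subgraph obtained by removing all vertices of faces in $S$) is empty or has a unique perfect matching. The resonance graph $R(G)$ has the perfect matchings of $G$ as vertices; $M_1$ and $M_2$ are adjacent if $M_1\oplus M_2$ is the edge set of exactly one cycle that is the periphery of a finite face $s$, and $s$ is then the face-label of the edge $M_1M_2$. A $k$-dimensional hypercube of $R(G)$ is a subgraph isomorphic to the Cartesian product of $k$ copies of $K_2$; it is nontrivial if $k\ge 1$. Two edges $x_1x_2$ and $y_1y_2$ of a connected graph $H$ are in relation $\Theta$ if $d_H(x_1,y_1)+d_H(x_2,y_2)\ne d_H(x_1,y_2)+d_H(x_2,y_1)$; the $\Theta$-class of an edge is the set of all edges in relation $\Theta$ with it. The $\Theta$-classes of a hypercube $Q$ are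 taken with $H=Q$, and a finite face is the face-label of a $\Theta$-class if it is the face-label of every edge in it. Let $\mathcal H(R(G))$ be the set of nontrivial hypercubes of $R(G)$ and $\mathcal{RS}(G)$ the set of nonempty resonant sets of $G$. 1. Every $\Theta$-class of a nontrivial hypercube of $R(G)$ has a unique face-label, and if $Q$ is a $k$-dimensional hypercube of $R(G)$, $k\ge1$, then the set $S_Q$ of the face-labels of the $\Theta$-classes of $Q$ is a resonant set of $G$ of cardinality $k$; it is the only resonant set of cardinality $k$ each of whose faces is the face-label of a $\Theta$-class of $Q$. Hence $f:\mathcal H(R(G))\to\mathcal{RS}(G)$, $f(Q)=S_Q$, is well-defined. 2. $f$ is surjective. 3. For every $k\ge1$ and every resonant set $S$ of $G$ of cardinality $k$, the fiber $f^{-1}(S)$ consists of exactly one hypercube, which is $k$-dimensional, if and only if $S$ is canonical. -/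

import Mathlib

namespace PlaneResonance

open Set

/-! ### Plane graphs and their faces -/

/-- A drawing of the simple graph `G` in the plane `ℂ = ℝ²`: distinct vertices are distinct points,
every edge is a simple arc joining the points of its two end vertices, and the interior of an edge
contains no vertex and no point of another edge. A graph with a drawing is a plane graph. -/
structure PlaneDrawing {V : Type*} (G : SimpleGraph V) where
  point : V → ℂ
  point_injective : Function.Injective point
  curve : G.edgeSet → C(unitInterval, ℂ)
  curve_injective : ∀ e, Function.Injective (curve e)
  curve_ends : ∀ e, s(curve e 0, curve e 1) = Sym2.map point e.1
  curve_avoids_vertices : ∀ e t v, curve e t = point v → t = 0 ∨ t = 1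
  curve_avoids_curves : ∀ e e', e ≠ e' → ∀ t t', curve e t = curve e' t' → t = 0 ∨ t = 1

variable {V : Type*} {G : SimpleGraph V}

/-- The point set of the plane graph. -/
def PlaneDrawing.support (D : PlaneDrawing G) : Set ℂ :=
  range D.point ∪ ⋃ e, range (D.curve e)

/-- The union of the arcs of the edges belonging to `C`. -/
def PlaneDrawing.trace (D : PlaneDrawing G) (C : Set (Sym2 V)) : Set ℂ :=
  ⋃ e : G.edgeSet, ⋃ _ : e.1 ∈ C, range (D.curve e)

/-- The faces of a plane graph are the connected components of the complement of its point set. -/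
def PlaneDrawing.IsFace (D : PlaneDrawing G) (s : Set ℂ) : Prop :=
  ∃ z ∈ D.supportᶜ, s = connectedComponentIn D.supportᶜ z

/-- The finite faces are the bounded ones. -/
def PlaneDrawing.FiniteFace (D : PlaneDrawing G) : Type :=
  {s : Set ℂ // D.IsFace s ∧ Bornology.IsBounded s}

/-- `v` is a vertex of the face `s`, that is, it lies on the boundary of `s`. -/
def PlaneDrawing.OnFace (D : PlaneDrawing G) (v : V) (s : D.FiniteFace) : Prop :=
  D.point v ∈ frontier s.1

/-- The closed walk `w` is a cycle, and it is the whole periphery of the face `s`. -/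
def PlaneDrawing.IsPeripheryCycle (D : PlaneDrawing G) (s : D.FiniteFace) {v : V}
    (w : G.Walk v v) : Prop :=
  w.IsCycle ∧ frontier s.1 = D.trace {e | e ∈ w.edges}

/-! ### Resonant sets -/

/-- The face `s` is `M`-resonant: its periphery is an `M`-alternating cycle. -/
def PlaneDrawing.IsResonantFace (D : PlaneDrawing G) (M : G.Subgraph) (s : D.FiniteFace) : Prop :=
  ∃ (v : V) (w : G.Walk v v), D.IsPeripheryCycle s w ∧
    w.toSubgraph.spanningCoe.IsAlternating M.spanningCoe

/-- Resonant sets: pairwise vertex disjoint finite faces, all of them `M`-resonant for one and the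
same perfect matching `M`. -/
def PlaneDrawing.IsResonantSet (D : PlaneDrawing G) (S : Set D.FiniteFace) : Prop :=
  (∀ s ∈ S, ∀ t ∈ S, s ≠ t → ∀ v, ¬ (D.OnFace v s ∧ D.OnFace v t)) ∧
    ∃ M : G.Subgraph, M.IsPerfectMatching ∧ ∀ s ∈ S, D.IsResonantFace M s

/-- The vertices of `G - S`: those that lie on no face of `S`. -/
def PlaneDrawing.remaining (D : PlaneDrawing G) (S : Set D.FiniteFace) : Set V :=
  {v | ∀ s ∈ S, ¬ D.OnFace v s}

/-- A resonant set `S` is canonical if `G - S` is empty or has a unique perfect matching. -/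
def PlaneDrawing.IsCanonical (D : PlaneDrawing G) (S : Set D.FiniteFace) : Prop :=
  D.IsResonantSet S ∧
    (D.remaining S = ∅ ∨ ∃! M : (G.induce (D.remaining S)).Subgraph, M.IsPerfectMatching)

/-! ### The resonance graph -/

/-- The perfect matchings of `G`. -/
abbrev PerfectMatching (G : SimpleGraph V) : Type _ :=
  {M : G.Subgraph // M.IsPerfectMatching}

/-- The symmetric difference of the perfect matchings `M₁` and `M₂` is the edge set of exactly one
cycle, which is the periphery of the finite face `s`. -/
def PlaneDrawing.DiffersBy (D : PlaneDrawing G) (M₁ M₂ : PerfectMatching G)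
    (s : D.FiniteFace) : Prop :=
  ∃ (v : V) (w : G.Walk v v), D.IsPeripheryCycle s w ∧
    symmDiff M₁.1.edgeSet M₂.1.edgeSet = {e | e ∈ w.edges}

theorem PlaneDrawing.DiffersBy.symm {D : PlaneDrawing G} {M₁ M₂ : PerfectMatching G}
    {s : D.FiniteFace} (h : D.DiffersBy M₁ M₂ s) : D.DiffersBy M₂ M₁ s := by
  obtain ⟨v, w, hw, h⟩ := h
  exact ⟨v, w, hw, by rw [symmDiff_comm, h]⟩

theorem PlaneDrawing.not_differsBy_self (D : PlaneDrawing G) (M : PerfectMatching G)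
    (s : D.FiniteFace) : ¬ D.DiffersBy M M s := by
  rintro ⟨v, w, ⟨hw, -⟩, h⟩
  rw [symmDiff_self] at h
  have h3 := hw.three_le_length
  rw [← SimpleGraph.Walk.length_edges] at h3
  obtain ⟨e, he⟩ := List.exists_mem_of_length_pos (by omega : 0 < w.edges.length)
  have : e ∈ (∅ : Set (Sym2 V)) := by
    have h' : e ∈ {e | e ∈ w.edges} := he
    rw [← h] at h'
    exact h'
  exact this

/-- The resonance graph `R(G)`. -/
def PlaneDrawing.resonanceGraph (D : PlaneDrawing G) : SimpleGraph (PerfectMatching G) where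
  Adj M₁ M₂ := ∃ s, D.DiffersBy M₁ M₂ s
  symm := ⟨fun _ _ ⟨s, h⟩ => ⟨s, h.symm⟩⟩
  loopless := ⟨fun M ⟨s, h⟩ => D.not_differsBy_self M s h⟩

/-! ### Hypercubes and the relation Θ -/

/-- The `k`-dimensional hypercube, the Cartesian product of `k` copies of `K₂`. -/
def hypercube (k : ℕ) : SimpleGraph (Fin k → Bool) where
  Adj x y := ∃ i, x i ≠ y i ∧ ∀ j, j ≠ i → x j = y j
  symm := ⟨fun _ _ ⟨i, hi, h⟩ => ⟨i, hi.symm, fun j hj => (h j hj).symm⟩⟩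
  loopless := ⟨fun _ ⟨_, hi, _⟩ => hi rfl⟩

/-- The subgraph `Q` is a `k`-dimensional hypercube. -/
def IsHypercube {W : Type*} {R : SimpleGraph W} (k : ℕ) (Q : R.Subgraph) : Prop :=
  Nonempty (Q.coe ≃g hypercube k)

/-- The Djoković–Winkler relation Θ between edges of `H`
(independent of the order in which the two ends of an edge are listed). -/
def Theta {W : Type*} (H : SimpleGraph W) (e e' : Sym2 W) : Prop :=
  ∃ x₁ x₂ y₁ y₂, e = s(x₁, x₂) ∧ e' = s(y₁, y₂) ∧
    H.dist x₁ y₁ + H.dist x₂ y₂ ≠ H.dist x₁ y₂ + H.dist x₂ y₁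

/-- `c` is a Θ-class of `H`: the set of all edges in relation Θ with a given edge of `H`. -/
def IsThetaClass {W : Type*} (H : SimpleGraph W) (c : Set (Sym2 W)) : Prop :=
  ∃ e ∈ H.edgeSet, c = {e' | e' ∈ H.edgeSet ∧ Theta H e e'}

/-- `s` is the face-label of the set `c` of edges of `Q`: every edge in `c` has face-label `s`. -/
def PlaneDrawing.IsFaceLabel (D : PlaneDrawing G) (Q : D.resonanceGraph.Subgraph)
    (c : Set (Sym2 Q.verts)) (s : D.FiniteFace) : Prop :=
  ∀ M₁ M₂ : Q.verts, s(M₁, M₂) ∈ c → D.DiffersBy M₁.1 M₂.1 s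

/-- The set of face-labels of the Θ-classes of `Q`. -/
def PlaneDrawing.faceLabels (D : PlaneDrawing G) (Q : D.resonanceGraph.Subgraph) :
    Set D.FiniteFace :=
  {s | ∃ c, IsThetaClass Q.coe c ∧ D.IsFaceLabel Q c s}

/-- The nontrivial hypercubes of `R(G)`. -/
def PlaneDrawing.Hypercubes (D : PlaneDrawing G) : Type _ :=
  {Q : D.resonanceGraph.Subgraph // ∃ k, 1 ≤ k ∧ IsHypercube k Q}

/-- The nonempty resonant sets of `G`. -/
def PlaneDrawing.ResonantSets (D : PlaneDrawing G) : Type _ :=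
  {S : Set D.FiniteFace // S.Nonempty ∧ D.IsResonantSet S}

end PlaneResonance

namespace PlaneResonance

open Set

/-! ### Continuous logarithms -/

/-! The topological core is a winding-number substitute for the Jordan curve theorem. Along the
periphery of a finite face `s`, the total increment of a continuous logarithm of `x - z`, with `z`
off the graph, vanishes exactly when `z ∉ s` (`IsPeripheryCycle.walkIncrement_eq_zero_iff`). This
follows from Borsuk's criterion: a vanishing increment would glue the logarithms along the edges
into a logarithm on the frontier of `s`.

Bipartiteness turns this into a potential on `R(G)`. Orient every edge by the 2-colouring and let
`matchingIncrement` add the increments over the edges of a matching. If `M₁ ⊕ M₂` is a cycle, its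
edges alternate between the matchings, so the two sums differ by ± the increment around the cycle.
Hence an edge of `R(G)` labelled `s` changes the potential at `z` iff `z ∈ s`. Labels are therefore
unique, and opposite edges of a square in a hypercube share their label, so each direction of a
hypercube has one label (`exists_isLabelling`). Θ-classes lie in directions, because distances in a
hypercube are Hamming distances. Distinct labels are vertex disjoint, since each remains resonant
after the other is flipped (`DiffersBy.not_onFace_and_onFace`).

Conversely, flipping all subsets of a resonant set `S`, starting from a matching for which all its
faces are resonant, gives a hypercube with label set `S` (`exists_isHypercube`). The restriction to
`G - S` is constant on such a hypercube and determines it (`mem_verts_of_restrict_eq`), and every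
perfect matching of `G - S` occurs (`exists_restrict_eq`). So the fiber over `S` corresponds to the
perfect matchings of `G - S`, and is a singleton iff `S` is canonical. -/

theorem exists_continuous_log {f : ℂ → ℂ} (hf : Continuous f) (h0 : ∀ x, f x ≠ 0) :
    ∃ g : ℂ → ℂ, Continuous g ∧ ∀ x, Complex.exp (g x) = f x := by
  -- The plane is simply connected, so `f` lifts through the covering `exp` of the punctured plane.
  obtain ⟨g, ⟨-, hg⟩, -⟩ := Complex.isCoveringMapOn_exp.existsUnique_continuousMap_lifts
    ⟨f, hf⟩ (a₀ := 0) (Complex.exp_log (h0 0)) h0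
  exact ⟨g, g.continuous, fun x => congrFun hg x⟩

theorem exists_continuous_log_path (f : C(unitInterval, ℂ)) (h0 : ∀ t, f t ≠ 0) :
    ∃ g : C(unitInterval, ℂ), ∀ t, Complex.exp (g t) = f t := by
  obtain ⟨g, hg, h⟩ := exists_continuous_log
    -- The path is extended to the whole plane by clamping the real part to `[0, 1]`.
    (f := fun x => f (projIcc (0 : ℝ) 1 zero_le_one x.re))
    (f.continuous.comp (continuous_projIcc.comp Complex.continuous_re)) (fun x => h0 _)
  refine ⟨⟨fun t => g ((t : ℝ) : ℂ), by fun_prop⟩, fun t => ?_⟩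
  simp [h]

/-- Along the circle, `g` differs from `m (log R + it)` by `2πi k(t)` with `k` continuous and
integer-valued, hence constant. One full turn then forces `2πi m = 0`. -/
theorem not_exists_log_zpow_on_sphere {z : ℂ} {R : ℝ} (hR : 0 < R) {m : ℤ} (hm : m ≠ 0)
    {g : ℂ → ℂ} (hg : Continuous g) : ¬ ∀ x, ‖x - z‖ = R → Complex.exp (g x) = (x - z) ^ m := by
  intro h
  let γ : ℝ → ℂ := fun t => z + R * Complex.exp (t * Complex.I)
  have hγ : Continuous γ := by fun_prop
  have hexp : ∀ t, Complex.exp (g (γ t) - m * (Real.log R + t * Complex.I)) = 1 := fun t => by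
    rw [Complex.exp_sub, h (γ t) (by simp [γ, Complex.norm_exp_ofReal_mul_I, abs_of_pos hR]),
      Complex.exp_int_mul, Complex.exp_add, ← Complex.ofReal_exp, Real.exp_log hR]
    simp only [γ, add_sub_cancel_left]
    refine div_self (zpow_ne_zero _ ?_)
    exact mul_ne_zero (by exact_mod_cast hR.ne') (Complex.exp_ne_zero _)
  choose k hk using fun t => Complex.exp_eq_one_iff.1 (hexp t)
  have hkc : Continuous fun t => ((k t : ℝ)) := by
    have : (fun t => ((k t : ℝ))) =
        fun t => ((g (γ t) - m * (Real.log R + t * Complex.I)) / (2 * Real.pi * Complex.I)).re := by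
      funext t
      rw [hk t, mul_div_cancel_right₀ _ Complex.two_pi_I_ne_zero]
      simp
    rw [this]
    fun_prop
  have hkc' : Continuous k := (Int.isClosedEmbedding_coe_real.isInducing.continuous_iff).2 hkc
  have hk0 : k 0 = k (2 * Real.pi) :=
    (IsPreconnected.constant isPreconnected_univ hkc'.continuousOn (mem_univ _) (mem_univ _))
  have e1 := hk 0
  have e2 := hk (2 * Real.pi)
  have hγ' : γ 0 = γ (2 * Real.pi) := by simp [γ]
  rw [← hk0, ← hγ', ← e1] at e2
  have : (m : ℂ) * (2 * Real.pi * Complex.I) = 0 := by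
    push_cast at e2
    linear_combination -e2
  exact (mul_ne_zero (by exact_mod_cast hm) Complex.two_pi_I_ne_zero) this

/-- A form of Borsuk's separation criterion. -/
theorem not_exists_log_of_frontier_subset {s K : Set ℂ} (hs : IsOpen s)
    (hb : Bornology.IsBounded s) (hK : IsClosed K) (hsK : frontier s ⊆ K) {z₁ z₂ : ℂ}
    (h₁ : z₁ ∈ s) (h₂ : z₂ ∉ closure s) {m n : ℤ} (hm : m ≠ 0) {g : ℂ → ℂ}
    (hg : ContinuousOn g K) :
    ¬ ∀ x ∈ K, Complex.exp (g x) = (x - z₁) ^ m * (x - z₂) ^ n := by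
  classical
  intro h
  obtain ⟨G, hG⟩ := ContinuousMap.exists_restrict_eq hK
    (⟨K.domRestrict g, continuousOn_iff_continuous_domRestrict.1 hg⟩ : C(K, ℂ))
  have hG' : ∀ x ∈ K, G x = g x := fun x hx => by
    simpa using congrArg (fun F : C(K, ℂ) => F ⟨x, hx⟩) hG
  have ne2 : ∀ x ∈ closure s, x - z₂ ≠ 0 := fun x hx h0 =>
    h₂ (by rwa [← sub_eq_zero.1 h0])
  have ne1 : ∀ x ∈ sᶜ, x - z₁ ≠ 0 := fun x hx h0 => hx (by rwa [sub_eq_zero.1 h0])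
  -- With `G` a Tietze extension of `g`, the assumed identity on `K` makes the two formulas agree on
  -- the frontier of `s`. The zero of `(x - z₁) ^ m` is thus removed, and `φ` is continuous and
  -- nonvanishing on the plane.
  let φ : ℂ → ℂ := fun x => if x ∈ closure s then Complex.exp (G x) * (x - z₂) ^ (-n)
    else (x - z₁) ^ m
  have φ1 : ∀ x ∈ closure s, φ x = Complex.exp (G x) * (x - z₂) ^ (-n) := fun x hx => if_pos hx
  have φ2 : ∀ x ∈ sᶜ, φ x = (x - z₁) ^ m := fun x hx => by
    by_cases hx' : x ∈ closure s
    · have hxK : x ∈ K := hsK (by rw [hs.frontier_eq]; exact ⟨hx', hx⟩)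
      rw [φ1 x hx', hG' x hxK, h x hxK, mul_assoc, ← zpow_add₀ (ne2 x hx')]
      simp
    · exact if_neg hx'
  have hφ : Continuous φ := by
    rw [← continuousOn_univ, ← union_compl_self s]
    have c1 : ContinuousOn φ (closure s) := by
      refine ContinuousOn.congr ?_ φ1
      refine ContinuousOn.mul (by fun_prop) ?_
      exact ContinuousOn.zpow₀ (by fun_prop) _ fun x hx => Or.inl (ne2 x hx)
    have c2 : ContinuousOn φ sᶜ := by
      refine ContinuousOn.congr ?_ φ2
      exact ContinuousOn.zpow₀ (by fun_prop) _ fun x hx => Or.inl (ne1 x hx)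
    exact (c1.union_of_isClosed c2 isClosed_closure hs.isClosed_compl).mono
      (union_subset_union_left _ subset_closure)
  have hφ0 : ∀ x, φ x ≠ 0 := fun x => by
    by_cases hx : x ∈ s
    · rw [φ1 x (subset_closure hx)]
      exact mul_ne_zero (Complex.exp_ne_zero _) (zpow_ne_zero _ (ne2 x (subset_closure hx)))
    · rw [φ2 x hx]
      exact zpow_ne_zero _ (ne1 x hx)
  obtain ⟨L, hL, hexp⟩ := exists_continuous_log hφ hφ0
  -- A circle enclosing `s` lies where `φ` is `(x - z₁) ^ m`, which has no logarithm there.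
  obtain ⟨R, hR0, hR⟩ := hb.subset_ball_lt 0 z₁
  refine not_exists_log_zpow_on_sphere (z := z₁) hR0 hm hL fun x hx => ?_
  rw [hexp, φ2 x]
  intro hxs
  have := hR hxs
  rw [mem_ball_iff_norm, hx] at this
  exact lt_irrefl _ this

variable {V : Type*} {G : SimpleGraph V}

/-! ### Logarithms along the edges of a plane graph -/

namespace PlaneDrawing

variable (D : PlaneDrawing G)

theorem point_eq_of_mem {e : G.edgeSet} {v : V} (hv : v ∈ e.1) :
    D.point v = D.curve e 0 ∨ D.point v = D.curve e 1 := by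
  have : D.point v ∈ Sym2.map D.point e.1 := Sym2.mem_map.2 ⟨v, hv, rfl⟩
  rwa [← D.curve_ends, Sym2.mem_iff] at this

theorem mem_of_curve_eq_point {e : G.edgeSet} {t : unitInterval} {v : V}
    (h : D.curve e t = D.point v) : v ∈ e.1 := by
  have : D.point v ∈ s(D.curve e 0, D.curve e 1) := by
    rw [Sym2.mem_iff]
    rcases D.curve_avoids_vertices e t v h with rfl | rfl
    · exact Or.inl h.symm
    · exact Or.inr h.symm
  rw [D.curve_ends, Sym2.mem_map] at this
  obtain ⟨a, ha, hav⟩ := this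
  rwa [D.point_injective hav] at ha

theorem exists_mem_curve_zero (e : G.edgeSet) : ∃ v ∈ e.1, D.point v = D.curve e 0 := by
  have : D.curve e 0 ∈ s(D.curve e 0, D.curve e 1) := Sym2.mem_mk_left _ _
  rwa [D.curve_ends, Sym2.mem_map] at this

theorem exists_mem_curve_one (e : G.edgeSet) : ∃ v ∈ e.1, D.point v = D.curve e 1 := by
  have : D.curve e 1 ∈ s(D.curve e 0, D.curve e 1) := Sym2.mem_mk_right _ _
  rwa [D.curve_ends, Sym2.mem_map] at this

theorem point_mem_support (v : V) : D.point v ∈ D.support := Or.inl ⟨v, rfl⟩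

theorem curve_mem_support (e : G.edgeSet) (t : unitInterval) : D.curve e t ∈ D.support :=
  Or.inr (mem_iUnion.2 ⟨e, t, rfl⟩)

theorem curve_mem_trace {C : Set (Sym2 V)} {e : G.edgeSet} (he : e.1 ∈ C) (t : unitInterval) :
    D.curve e t ∈ D.trace C := mem_iUnion₂.2 ⟨e, he, t, rfl⟩

theorem mem_trace {C : Set (Sym2 V)} {x : ℂ} :
    x ∈ D.trace C ↔ ∃ e : G.edgeSet, e.1 ∈ C ∧ ∃ t, D.curve e t = x := by
  simp [trace]

theorem trace_subset_support (C : Set (Sym2 V)) : D.trace C ⊆ D.support := by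
  intro x hx
  obtain ⟨e, -, t, rfl⟩ := D.mem_trace.1 hx
  exact D.curve_mem_support e t

/-- A family of continuous logarithms of `f` along the edges. -/
def IsEdgeLog (f : ℂ → ℂ) (l : G.edgeSet → C(unitInterval, ℂ)) : Prop :=
  ∀ e t, Complex.exp (l e t) = f (D.curve e t)

theorem exists_isEdgeLog {z : ℂ} (hz : z ∉ D.support) :
    ∃ l, D.IsEdgeLog (fun x => x - z) l := by
  choose l hl using fun e : G.edgeSet =>
    exists_continuous_log_path ⟨fun t => D.curve e t - z, by fun_prop⟩ (fun t h => hz (by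
      have h' : D.curve e t - z = 0 := h
      rw [← sub_eq_zero.1 h']
      exact D.curve_mem_support e t))
  exact ⟨l, hl⟩

open Classical in
/-- The value of the logarithm `l e` at the end `v` of the edge `e`. -/
noncomputable def endValue (l : G.edgeSet → C(unitInterval, ℂ)) (e : G.edgeSet) (v : V) : ℂ :=
  -- The value is meaningful only when `v` is an end of `e`; the second branch also catches all
  -- other vertices.
  if D.point v = D.curve e 0 then l e 0 else l e 1

/-- The increment of the logarithm `l` along a dart. -/
noncomputable def increment (l : G.edgeSet → C(unitInterval, ℂ)) (d : G.Dart) : ℂ :=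
  D.endValue l ⟨d.edge, d.edge_mem⟩ d.snd - D.endValue l ⟨d.edge, d.edge_mem⟩ d.fst

variable {D} {f : ℂ → ℂ} {l : G.edgeSet → C(unitInterval, ℂ)}

theorem endValue_eq_of_curve_eq {e : G.edgeSet} {t : unitInterval} {v : V}
    (h : D.curve e t = D.point v) : D.endValue l e v = l e t := by
  rcases D.curve_avoids_vertices e t v h with rfl | rfl
  · exact if_pos h.symm
  · refine if_neg fun h' => ?_
    have := D.curve_injective e (h.trans h')
    exact one_ne_zero this

theorem IsEdgeLog.exp_endValue (hl : D.IsEdgeLog f l) {e : G.edgeSet} {v : V} (hv : v ∈ e.1) :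
    Complex.exp (D.endValue l e v) = f (D.point v) := by
  rcases D.point_eq_of_mem hv with h | h <;> rw [endValue_eq_of_curve_eq h.symm, hl, h]

theorem IsEdgeLog.exp_increment (hl : D.IsEdgeLog f l) (d : G.Dart) :
    Complex.exp (D.increment l d) = f (D.point d.snd) / f (D.point d.fst) := by
  rw [increment, Complex.exp_sub, hl.exp_endValue (e := ⟨d.edge, d.edge_mem⟩) (Sym2.mem_mk_right _ _),
    hl.exp_endValue (e := ⟨d.edge, d.edge_mem⟩) (Sym2.mem_mk_left _ _)]

variable (D l) in
theorem increment_symm (d : G.Dart) : D.increment l d.symm = - D.increment l d := by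
  have h : (⟨d.symm.edge, d.symm.edge_mem⟩ : G.edgeSet) = ⟨d.edge, d.edge_mem⟩ :=
    Subtype.ext d.edge_symm
  unfold increment
  rw [h]
  simp

variable (D l) in
/-- The total increment of the logarithm `l` along a walk. -/
noncomputable def walkIncrement {u v : V} (p : G.Walk u v) : ℂ :=
  (p.darts.map (D.increment l)).sum

theorem walkIncrement_eq_sub {u v : V} (p : G.Walk u v) (P : V → ℂ)
    (h : ∀ d ∈ p.darts, P d.snd - P d.fst = D.increment l d) :
    D.walkIncrement l p = P v - P u := by
  induction p with
  | nil => simp [walkIncrement]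
  | cons hadj p ih =>
    have h1 := h ⟨(_, _), hadj⟩ (by simp)
    have h2 := ih fun d hd => h d (by simp [hd])
    simp only [walkIncrement, SimpleGraph.Walk.darts_cons, List.map_cons, List.sum_cons] at h2 ⊢
    rw [h2, ← h1]
    simp

/-- A path does not revisit its first vertex, so the value there can be set without disturbing the
rest. -/
theorem IsEdgeLog.exists_potential_of_isPath (hl : D.IsEdgeLog f l)
    (hf : ∀ v, f (D.point v) ≠ 0) {u v : V} (p : G.Walk u v) (hp : p.IsPath) :
    ∃ P : V → ℂ, (∀ d ∈ p.darts, P d.snd - P d.fst = D.increment l d) ∧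
      ∀ x ∈ p.support, Complex.exp (P x) = f (D.point x) := by
  classical
  induction p with
  | nil =>
    refine ⟨fun x => Complex.log (f (D.point x)), by simp, ?_⟩
    intro x _
    exact Complex.exp_log (hf x)
  | @cons u v w hadj p ih =>
    obtain ⟨hp', hu⟩ := (SimpleGraph.Walk.cons_isPath_iff _ _).1 hp
    obtain ⟨P, hP, hP'⟩ := ih hp'
    have key : ∀ x ∈ p.support, Function.update P u (P v - D.increment l ⟨(u, v), hadj⟩) x = P x :=
      fun x hx => Function.update_of_ne (ne_of_mem_of_not_mem hx hu) _ _
    refine ⟨Function.update P u (P v - D.increment l ⟨(u, v), hadj⟩), fun d hd => ?_, fun x hx => ?_⟩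
    · rw [SimpleGraph.Walk.darts_cons, List.mem_cons] at hd
      rcases hd with rfl | hd
      · rw [key v p.start_mem_support]
        simp
      · rw [key _ (p.dart_fst_mem_support_of_mem_darts hd),
          key _ (p.dart_snd_mem_support_of_mem_darts hd), hP d hd]
    · rw [SimpleGraph.Walk.support_cons, List.mem_cons] at hx
      rcases hx with rfl | hx
      · rw [Function.update_self, Complex.exp_sub, hP' v p.start_mem_support, hl.exp_increment]
        exact div_div_cancel₀ (hf v)
      · rw [key x hx, hP' x hx]

/-- Dropping the first edge leaves a path; a zero total increment is exactly consistency across the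
dropped edge. -/
theorem IsEdgeLog.exists_potential_of_isCycle (hl : D.IsEdgeLog f l)
    (hf : ∀ v, f (D.point v) ≠ 0) {u : V} (w : G.Walk u u) (hw : w.IsCycle)
    (h0 : D.walkIncrement l w = 0) :
    ∃ P : V → ℂ, (∀ d ∈ w.darts, P d.snd - P d.fst = D.increment l d) ∧
      ∀ x ∈ w.support, Complex.exp (P x) = f (D.point x) := by
  cases w with
  | nil => exact absurd hw SimpleGraph.Walk.not_isCycle_nil
  | @cons _ v _ hadj p =>
    obtain ⟨hp, -⟩ := (SimpleGraph.Walk.cons_isCycle_iff _ _).1 hw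
    obtain ⟨P, hP, hP'⟩ := hl.exists_potential_of_isPath hf p hp
    have h1 := walkIncrement_eq_sub p P hP
    simp only [walkIncrement, SimpleGraph.Walk.darts_cons, List.map_cons, List.sum_cons] at h0 h1
    refine ⟨P, fun d hd => ?_, fun x hx => ?_⟩
    · rw [SimpleGraph.Walk.darts_cons, List.mem_cons] at hd
      rcases hd with rfl | hd
      · simp only
        linear_combination h1 - h0
      · exact hP d hd
    · rw [SimpleGraph.Walk.support_cons, List.mem_cons] at hx
      rcases hx with rfl | hx
      · exact hP' _ p.end_mem_support
      · exact hP' x hx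

/-- The constants `κ e`, multiples of `2πi`, shift the logarithms so that edges meeting at a vertex
agree there. Continuity then pastes over finitely many closed arcs. -/
theorem exists_log_on_trace [Finite V] {C : Set (Sym2 V)} (hl : D.IsEdgeLog f l) {P : V → ℂ}
    {κ : G.edgeSet → ℂ} (hκ : ∀ e : G.edgeSet, e.1 ∈ C → Complex.exp (κ e) = 1)
    (hP : ∀ e : G.edgeSet, e.1 ∈ C → ∀ v ∈ e.1, P v = D.endValue l e v + κ e) :
    ∃ g : ℂ → ℂ, ContinuousOn g (D.trace C) ∧ ∀ x ∈ D.trace C, Complex.exp (g x) = f x := by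
  classical
  have wd : ∀ (e e' : G.edgeSet) t t', e.1 ∈ C → e'.1 ∈ C → D.curve e t = D.curve e' t' →
      l e t + κ e = l e' t' + κ e' := by
    intro e e' t t' he he' h
    by_cases hee : e = e'
    · subst hee
      rw [D.curve_injective e h]
    · obtain ⟨v, hv, hvt⟩ : ∃ v ∈ e.1, D.point v = D.curve e t := by
        rcases D.curve_avoids_curves e e' hee t t' h with rfl | rfl
        · exact D.exists_mem_curve_zero e
        · exact D.exists_mem_curve_one e
      have hv' : v ∈ e'.1 := D.mem_of_curve_eq_point (h.symm.trans hvt.symm)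
      have h1 := hP e he v hv
      have h2 := hP e' he' v hv'
      rw [endValue_eq_of_curve_eq hvt.symm] at h1
      rw [endValue_eq_of_curve_eq (h.symm.trans hvt.symm)] at h2
      rw [← h1, ← h2]
  let g : ℂ → ℂ := fun x =>
    if h : ∃ (e : G.edgeSet) (t : unitInterval), e.1 ∈ C ∧ D.curve e t = x then
      l h.choose h.choose_spec.choose + κ h.choose else 0
  have hg : ∀ (e : G.edgeSet) t, e.1 ∈ C → g (D.curve e t) = l e t + κ e := by
    intro e t he
    have h : ∃ (e' : G.edgeSet) (t' : unitInterval), e'.1 ∈ C ∧ D.curve e' t' = D.curve e t :=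
      ⟨e, t, he, rfl⟩
    simp only [g, dif_pos h]
    exact wd _ _ _ _ h.choose_spec.choose_spec.1 he h.choose_spec.choose_spec.2
  refine ⟨g, ?_, fun x hx => ?_⟩
  · have : Finite G.edgeSet := Subtype.finite
    have htr : D.trace C = ⋃ e : {e : G.edgeSet // e.1 ∈ C}, range (D.curve e.1) := by
      ext x
      simp [trace]
    rw [htr]
    refine (locallyFinite_of_finite _).continuousOn_iUnion
      (fun e => (isCompact_range (D.curve e.1).continuous).isClosed) fun e => ?_
    have hemb : Topology.IsClosedEmbedding (D.curve e.1) :=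
      (D.curve e.1).continuous.isClosedEmbedding (D.curve_injective e.1)
    rw [← image_univ, hemb.isInducing.continuousOn_image_iff]
    refine ContinuousOn.congr (f := fun t => l e.1 t + κ e.1) (by fun_prop) fun t _ => hg _ _ e.2
  · obtain ⟨e, he, t, rfl⟩ := D.mem_trace.1 hx
    rw [hg e t he, Complex.exp_add, hκ e he, hl, mul_one]

theorem IsEdgeLog.exists_log_of_walkIncrement_eq_zero [Finite V] (hl : D.IsEdgeLog f l)
    (hf : ∀ v, f (D.point v) ≠ 0) {u : V} (w : G.Walk u u) (hw : w.IsCycle)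
    (h0 : D.walkIncrement l w = 0) :
    ∃ g : ℂ → ℂ, ContinuousOn g (D.trace {e | e ∈ w.edges}) ∧
      ∀ x ∈ D.trace {e | e ∈ w.edges}, Complex.exp (g x) = f x := by
  obtain ⟨P, hP, hP'⟩ := hl.exists_potential_of_isCycle hf w hw h0
  have key : ∀ e : G.edgeSet, e.1 ∈ {e | e ∈ w.edges} → ∃ c : ℂ, Complex.exp c = 1 ∧
      ∀ v ∈ e.1, P v = D.endValue l e v + c := by
    rintro ⟨e, he⟩ hew
    obtain ⟨d, hd, rfl⟩ := List.mem_map.1 (show e ∈ w.edges from hew)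
    have h1 := hP d hd
    refine ⟨P d.fst - D.endValue l ⟨d.edge, he⟩ d.fst, ?_, fun v hv => ?_⟩
    · rw [Complex.exp_sub, hP' _ (w.dart_fst_mem_support_of_mem_darts hd),
        hl.exp_endValue (e := ⟨d.edge, he⟩) (Sym2.mem_mk_left _ _), div_self (hf _)]
    · rcases Sym2.mem_iff.1 hv with rfl | rfl
      · ring
      · unfold increment at h1
        linear_combination h1
  choose! κ h1 h2 using key
  exact exists_log_on_trace hl h1 h2

end PlaneDrawing

/-! ### Increments around the periphery of a face -/

namespace PlaneDrawing

variable {D : PlaneDrawing G} {f : ℂ → ℂ} {l : G.edgeSet → C(unitInterval, ℂ)}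

theorem isClosed_support [Finite V] (D : PlaneDrawing G) : IsClosed D.support := by
  have : Finite G.edgeSet := Subtype.finite
  exact (finite_range _).isClosed.union
    (isClosed_iUnion_of_finite fun e => (isCompact_range (D.curve e).continuous).isClosed)

theorem isClosed_trace [Finite V] (D : PlaneDrawing G) (C : Set (Sym2 V)) :
    IsClosed (D.trace C) := by
  have : Finite G.edgeSet := Subtype.finite
  exact isClosed_iUnion_of_finite fun e => isClosed_iUnion_of_finite fun _ =>
    (isCompact_range (D.curve e).continuous).isClosed

theorem IsFace.isOpen [Finite V] {s : Set ℂ} (hs : D.IsFace s) : IsOpen s := by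
  obtain ⟨z, -, rfl⟩ := hs
  exact D.isClosed_support.isOpen_compl.connectedComponentIn

theorem IsFace.subset {s : Set ℂ} (hs : D.IsFace s) : s ⊆ D.supportᶜ := by
  obtain ⟨z, -, rfl⟩ := hs
  exact connectedComponentIn_subset _ _

theorem IsFace.nonempty {s : Set ℂ} (hs : D.IsFace s) : s.Nonempty := by
  obtain ⟨z, hz, rfl⟩ := hs
  exact ⟨z, mem_connectedComponentIn hz⟩

theorem IsFace.eq_of_mem {s t : Set ℂ} (hs : D.IsFace s) (ht : D.IsFace t) {z : ℂ}
    (hzs : z ∈ s) (hzt : z ∈ t) : s = t := by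
  obtain ⟨x, -, rfl⟩ := hs
  obtain ⟨y, -, rfl⟩ := ht
  rw [connectedComponentIn_eq hzs, connectedComponentIn_eq hzt]

theorem IsEdgeLog.exp_walkIncrement (hl : D.IsEdgeLog f l) (hf : ∀ v, f (D.point v) ≠ 0)
    {u v : V} (p : G.Walk u v) :
    Complex.exp (D.walkIncrement l p) = f (D.point v) / f (D.point u) := by
  induction p with
  | nil => simp [walkIncrement, hf]
  | cons hadj p ih =>
    simp only [walkIncrement, SimpleGraph.Walk.darts_cons, List.map_cons, List.sum_cons] at ih ⊢
    rw [Complex.exp_add, ih, hl.exp_increment]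
    exact div_mul_div_cancel₀' (hf _) _ _

theorem walkIncrement_combination (l₁ l₂ : G.edgeSet → C(unitInterval, ℂ)) (m n : ℂ) {u v : V}
    (p : G.Walk u v) :
    D.walkIncrement (fun e => m • l₁ e + n • l₂ e) p =
      m * D.walkIncrement l₁ p + n * D.walkIncrement l₂ p := by
  have h : ∀ d : G.Dart, D.increment (fun e => m • l₁ e + n • l₂ e) d =
      m * D.increment l₁ d + n * D.increment l₂ d := fun d => by
    unfold increment endValue
    split_ifs <;> simp <;> ring
  simp only [walkIncrement, funext h, List.sum_map_add, List.sum_map_mul_left]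

theorem IsEdgeLog.combination {f₁ f₂ : ℂ → ℂ} {l₁ l₂ : G.edgeSet → C(unitInterval, ℂ)}
    (h₁ : D.IsEdgeLog f₁ l₁) (h₂ : D.IsEdgeLog f₂ l₂) (m n : ℤ) :
    D.IsEdgeLog (fun x => f₁ x ^ m * f₂ x ^ n)
      (fun e => (m : ℂ) • l₁ e + (n : ℂ) • l₂ e) := fun e t => by
  simp [Complex.exp_add, Complex.exp_int_mul, h₁ e t, h₂ e t]

theorem sub_point_ne_zero {z : ℂ} (hz : z ∉ D.support) (v : V) : D.point v - z ≠ 0 := fun h =>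
  hz (by rw [← sub_eq_zero.1 h]; exact D.point_mem_support v)

/-- The sum is the increment of a logarithm of `(x - z₁) ^ m * (x - z₂) ^ n`. If it vanished, this
function would have a logarithm on the frontier of `s`, against Borsuk's criterion. -/
theorem IsPeripheryCycle.combination_ne_zero [Finite V] {s : D.FiniteFace} {u : V} {w : G.Walk u u}
    (hw : D.IsPeripheryCycle s w) {z₁ z₂ : ℂ} (h₁ : z₁ ∈ s.1) (h₂ : z₂ ∉ s.1)
    (hz₂ : z₂ ∉ D.support) {l₁ l₂ : G.edgeSet → C(unitInterval, ℂ)}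
    (hl₁ : D.IsEdgeLog (fun x => x - z₁) l₁) (hl₂ : D.IsEdgeLog (fun x => x - z₂) l₂)
    {m n : ℤ} (hm : m ≠ 0) :
    m * D.walkIncrement l₁ w + n * D.walkIncrement l₂ w ≠ 0 := by
  intro h0
  rw [← walkIncrement_combination] at h0
  have hz₁ : z₁ ∉ D.support := s.2.1.subset h₁
  obtain ⟨g, hg, hexp⟩ := (hl₁.combination hl₂ m n).exists_log_of_walkIncrement_eq_zero
    (fun v => mul_ne_zero (zpow_ne_zero _ (sub_point_ne_zero hz₁ v))
      (zpow_ne_zero _ (sub_point_ne_zero hz₂ v))) w hw.1 h0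
  have hcl : z₂ ∉ closure s.1 := by
    rw [closure_eq_self_union_frontier, hw.2]
    rintro (h | h)
    · exact h₂ h
    · exact hz₂ (D.trace_subset_support _ h)
  exact not_exists_log_of_frontier_subset s.2.1.isOpen s.2.2 (D.isClosed_trace _) hw.2.subset h₁
    hcl hm hg hexp

theorem FiniteFace.exists_notMem [Finite V] (s : D.FiniteFace) :
    ∃ z, z ∉ s.1 ∧ z ∉ D.support := by
  have : Finite G.edgeSet := Subtype.finite
  have hb : Bornology.IsBounded (s.1 ∪ D.support) :=
    s.2.2.union ((finite_range _).isBounded.union ((Bornology.isBounded_iUnion).2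
      fun e => (isCompact_range (D.curve e).continuous).isBounded))
  obtain ⟨z, hz⟩ := (ne_univ_iff_exists_notMem _).1
    (fun h => NormedSpace.unbounded_univ ℂ ℂ (h ▸ hb) : s.1 ∪ D.support ≠ univ)
  exact ⟨z, fun h => hz (Or.inl h), fun h => hz (Or.inr h)⟩

theorem IsPeripheryCycle.walkIncrement_eq_zero_iff [Finite V] {s : D.FiniteFace} {u : V}
    {w : G.Walk u u} (hw : D.IsPeripheryCycle s w) {z : ℂ} (hz : z ∉ D.support)
    (hl : D.IsEdgeLog (fun x => x - z) l) : D.walkIncrement l w = 0 ↔ z ∉ s.1 := by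
  constructor
  · intro h0 hzs
    obtain ⟨z', h1, h2⟩ := s.exists_notMem
    obtain ⟨l', hl'⟩ := D.exists_isEdgeLog h2
    refine hw.combination_ne_zero hzs h1 h2 hl hl' (m := 1) (n := 0) one_ne_zero ?_
    simp [h0]
  · intro hzs
    obtain ⟨z', h1⟩ := s.2.1.nonempty
    have h2 := s.2.1.subset h1
    obtain ⟨l', hl'⟩ := D.exists_isEdgeLog h2
    have e1 := hl.exp_walkIncrement (sub_point_ne_zero hz) w
    have e2 := hl'.exp_walkIncrement (sub_point_ne_zero h2) w
    rw [div_self (sub_point_ne_zero hz _)] at e1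
    rw [div_self (sub_point_ne_zero h2 _)] at e2
    obtain ⟨n, hn⟩ := Complex.exp_eq_one_iff.1 e1
    obtain ⟨m, hm⟩ := Complex.exp_eq_one_iff.1 e2
    by_cases hn0 : n = 0
    · simp [hn, hn0]
    -- The increments about `z'` and `z` are `2πi m` and `2πi n`; the exponents `n` and `-m` make
    -- them cancel.
    · refine absurd ?_ (hw.combination_ne_zero h1 hzs hz hl' hl (m := n) (n := -m) hn0)
      rw [hn, hm]
      push_cast
      ring

/-! ### Increments of perfect matchings of a bipartite graph -/

open Classical in
/-- The increment of `l` along `e`, directed from the end coloured `false` to the one coloured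
`true`. -/
noncomputable def directedIncrement (D : PlaneDrawing G) (c : G.Coloring Bool)
    (l : G.edgeSet → C(unitInterval, ℂ)) (e : Sym2 V) : ℂ :=
  if h : ∃ d : G.Dart, d.edge = e then
    (if c h.choose.fst then -1 else 1) * D.increment l h.choose else 0

/-- Reversing a dart changes both the colour sign and the increment, so the chosen dart is
immaterial. -/
theorem directedIncrement_edge (c : G.Coloring Bool) (d : G.Dart) :
    D.directedIncrement c l d.edge = (if c d.fst then -1 else 1) * D.increment l d := by
  have h : ∃ d' : G.Dart, d'.edge = d.edge := ⟨d, rfl⟩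
  rw [directedIncrement, dif_pos h]
  rcases (SimpleGraph.dart_edge_eq_iff _ _).1 h.choose_spec with h' | h'
  · rw [h']
  · rw [h', increment_symm]
    have := c.valid d.adj
    have h2 : d.symm.fst = d.snd := rfl
    rw [h2]
    cases h3 : c d.fst <;> cases h4 : c d.snd <;> simp_all

open Classical in
/-- The sum of the directed increments over the edges of a matching. -/
noncomputable def matchingIncrement [Finite V] (D : PlaneDrawing G) (c : G.Coloring Bool)
    (l : G.edgeSet → C(unitInterval, ℂ)) (M : G.Subgraph) : ℂ :=
  ∑ᶠ e : Sym2 V, if e ∈ M.edgeSet then D.directedIncrement c l e else 0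

end PlaneDrawing

theorem eq_of_mem_edgeSet {M : G.Subgraph} (hM : M.IsPerfectMatching) {e e' : Sym2 V} {v : V}
    (he : e ∈ M.edgeSet) (he' : e' ∈ M.edgeSet) (hv : v ∈ e) (hv' : v ∈ e') : e = e' := by
  obtain ⟨a, rfl⟩ := Sym2.mem_iff_exists.1 hv
  obtain ⟨b, rfl⟩ := Sym2.mem_iff_exists.1 hv'
  rw [hM.1.eq_of_adj_left (SimpleGraph.Subgraph.mem_edgeSet.1 he)
    (SimpleGraph.Subgraph.mem_edgeSet.1 he')]

open Classical in
/-- The indicator of `M₂` minus the indicator of `M₁`. -/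
noncomputable def matchingSign (M₁ M₂ : G.Subgraph) (e : Sym2 V) : ℂ :=
  (if e ∈ M₂.edgeSet then 1 else 0) - (if e ∈ M₁.edgeSet then 1 else 0)

/-- Consecutive edges of a trail are distinct, so they cannot lie in the same matching: the matching
sign alternates along the trail, as does the colour of the starting vertices. The two signs agree up
to one global factor `a`. -/
theorem exists_matchingSign_eq (c : G.Coloring Bool) {M₁ M₂ : G.Subgraph}
    (h₁ : M₁.IsPerfectMatching) (h₂ : M₂.IsPerfectMatching) {u v : V} (p : G.Walk u v)
    (hp : p.IsTrail) (hsub : ∀ e ∈ p.edges, e ∈ symmDiff M₁.edgeSet M₂.edgeSet) :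
    ∃ a : ℂ, a * a = 1 ∧ ∀ d ∈ p.darts,
      a * matchingSign M₁ M₂ d.edge = (if c d.fst then -1 else 1) := by
  induction p with
  | nil => exact ⟨1, by simp, by simp⟩
  | @cons u v w hadj p ih =>
    obtain ⟨a, ha, had⟩ := ih hp.of_cons fun e he => hsub e (by simp [he])
    have hs : ∀ e ∈ symmDiff M₁.edgeSet M₂.edgeSet,
        matchingSign M₁ M₂ e * matchingSign M₁ M₂ e = 1 := by
      rintro e (⟨h, h'⟩ | ⟨h, h'⟩) <;> simp [matchingSign, h, h']
    have he1 := hsub s(u, v) (by simp)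
    cases p with
    | nil =>
      refine ⟨(if c u then -1 else 1) * matchingSign M₁ M₂ s(u, v), ?_, fun d hd => ?_⟩
      · have := hs _ he1
        split_ifs <;> linear_combination this
      · simp only [SimpleGraph.Walk.darts_cons, SimpleGraph.Walk.darts_nil, List.mem_singleton] at hd
        subst hd
        have := hs _ he1
        change _ * matchingSign M₁ M₂ s(u, v) = _
        rw [mul_assoc, this, mul_one]
    | @cons _ x _ hadj' p =>
      refine ⟨a, ha, fun d hd => ?_⟩
      rw [SimpleGraph.Walk.darts_cons, List.mem_cons] at hd
      rcases hd with rfl | hd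
      · have h3 := had ⟨(v, x), hadj'⟩ (by simp)
        have hne : s(u, v) ≠ s(v, x) := by
          intro h
          have := ((SimpleGraph.Walk.isTrail_cons _ _).1 hp).2
          simp [h] at this
        have he2 := hsub s(v, x) (by simp)
        have hcol := c.valid hadj
        have hsgn : matchingSign M₁ M₂ s(u, v) = - matchingSign M₁ M₂ s(v, x) := by
          have n1 : ¬ (s(u, v) ∈ M₁.edgeSet ∧ s(v, x) ∈ M₁.edgeSet) := fun h =>
            hne (eq_of_mem_edgeSet h₁ h.1 h.2 (Sym2.mem_mk_right _ _) (Sym2.mem_mk_left _ _))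
          have n2 : ¬ (s(u, v) ∈ M₂.edgeSet ∧ s(v, x) ∈ M₂.edgeSet) := fun h =>
            hne (eq_of_mem_edgeSet h₂ h.1 h.2 (Sym2.mem_mk_right _ _) (Sym2.mem_mk_left _ _))
          rcases he1 with ⟨h, h'⟩ | ⟨h, h'⟩ <;> rcases he2 with ⟨k, k'⟩ | ⟨k, k'⟩ <;>
            simp_all [matchingSign]
        change a * matchingSign M₁ M₂ s(u, v) = (if c u then -1 else 1)
        change a * matchingSign M₁ M₂ s(v, x) = (if c v then -1 else 1) at h3
        rw [hsgn, mul_neg, h3]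
        cases h5 : c u <;> cases h6 : c v <;> simp_all
      · exact had d hd

namespace PlaneDrawing

variable {D : PlaneDrawing G} {l : G.edgeSet → C(unitInterval, ℂ)}

theorem walkIncrement_eq_zero_iff_matchingIncrement_eq [Finite V] (c : G.Coloring Bool)
    {M₁ M₂ : G.Subgraph} (h₁ : M₁.IsPerfectMatching) (h₂ : M₂.IsPerfectMatching) {u : V}
    (w : G.Walk u u) (hw : w.IsCycle) (h : symmDiff M₁.edgeSet M₂.edgeSet = {e | e ∈ w.edges}) :
    D.walkIncrement l w = 0 ↔ D.matchingIncrement c l M₁ = D.matchingIncrement c l M₂ := by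
  classical
  have := Fintype.ofFinite V
  obtain ⟨a, ha, had⟩ := exists_matchingSign_eq c h₁ h₂ w hw.1.1 (fun e he => by rw [h]; exact he)
  have e1 : D.matchingIncrement c l M₂ - D.matchingIncrement c l M₁ =
      ∑ e : Sym2 V, matchingSign M₁ M₂ e * D.directedIncrement c l e := by
    simp only [matchingIncrement, finsum_eq_sum_of_fintype, ← Finset.sum_sub_distrib]
    refine Finset.sum_congr rfl fun e _ => ?_
    simp only [matchingSign]
    split_ifs <;> ring
  have e2 : ∑ e : Sym2 V, matchingSign M₁ M₂ e * D.directedIncrement c l e =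
      ∑ e ∈ w.edges.toFinset, matchingSign M₁ M₂ e * D.directedIncrement c l e := by
    symm
    refine Finset.sum_subset (Finset.subset_univ _) fun e _ he => ?_
    have : e ∉ symmDiff M₁.edgeSet M₂.edgeSet := by
      rw [h]
      simpa using he
    rw [mem_symmDiff] at this
    by_cases k1 : e ∈ M₁.edgeSet <;> by_cases k2 : e ∈ M₂.edgeSet <;>
      simp_all [matchingSign]
  have e3 : ∑ e ∈ w.edges.toFinset, matchingSign M₁ M₂ e * D.directedIncrement c l e =
      a * D.walkIncrement l w := by
    rw [List.sum_toFinset _ hw.1.1.edges_nodup, SimpleGraph.Walk.edges, List.map_map,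
      walkIncrement, ← List.sum_map_mul_left]
    refine congrArg List.sum (List.map_congr_left fun d hd => ?_)
    have h3 := had d hd
    simp only [Function.comp_apply]
    rw [directedIncrement_edge, ← h3]
    have h4 : (a * matchingSign M₁ M₂ d.edge) * (a * matchingSign M₁ M₂ d.edge) = 1 := by
      rw [h3]
      split_ifs <;> norm_num
    linear_combination a * D.increment l d * h4 -
      a * D.increment l d * matchingSign M₁ M₂ d.edge ^ 2 * ha
  rw [e2, e3] at e1
  have ha0 : a ≠ 0 := fun h => by simp [h] at ha
  rw [eq_comm (a := D.matchingIncrement c l M₁),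
    ← sub_eq_zero (a := D.matchingIncrement c l M₂), e1, mul_eq_zero]
  simp [ha0]

/-- This is the invariant behind all statements on labels: the potential at `z` detects exactly the
edges of `R(G)` whose label contains `z`. -/
theorem DiffersBy.matchingIncrement_eq_iff [Finite V] (c : G.Coloring Bool)
    {M₁ M₂ : PerfectMatching G} {s : D.FiniteFace} (h : D.DiffersBy M₁ M₂ s) {z : ℂ}
    (hz : z ∉ D.support) (hl : D.IsEdgeLog (fun x => x - z) l) :
    D.matchingIncrement c l M₁.1 = D.matchingIncrement c l M₂.1 ↔ z ∉ s.1 := by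
  obtain ⟨v, w, hw, h⟩ := h
  rw [← hw.walkIncrement_eq_zero_iff hz hl,
    walkIncrement_eq_zero_iff_matchingIncrement_eq c M₁.2 M₂.2 w hw.1 h]

/-! ### Face-labels -/

theorem FiniteFace.eq_of_mem {s t : D.FiniteFace} {z : ℂ} (hs : z ∈ s.1) (ht : z ∈ t.1) : s = t :=
  Subtype.ext (s.2.1.eq_of_mem t.2.1 hs ht)

theorem DiffersBy.label_unique [Finite V] (hG : G.IsBipartite) {M₁ M₂ : PerfectMatching G}
    {s t : D.FiniteFace} (hs : D.DiffersBy M₁ M₂ s) (ht : D.DiffersBy M₁ M₂ t) : s = t := by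
  have c : G.Coloring Bool := hG.toColoring (by simp)
  obtain ⟨z, hzs⟩ := s.2.1.nonempty
  have hz := s.2.1.subset hzs
  obtain ⟨l, hl⟩ := D.exists_isEdgeLog hz
  have h := (hs.matchingIncrement_eq_iff c hz hl).symm.trans (ht.matchingIncrement_eq_iff c hz hl)
  exact FiniteFace.eq_of_mem hzs (not_not.1 fun h' => h.2 h' hzs)

/-- In a closed walk of length four of the resonance graph, a face-label different from those of
the two neighbouring edges is the one of the opposite edge. -/
theorem DiffersBy.label_opposite [Finite V] (hG : G.IsBipartite) {M₁ M₂ M₃ M₄ : PerfectMatching G}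
    {a b a' b' : D.FiniteFace} (h₁₂ : D.DiffersBy M₁ M₂ a) (h₂₃ : D.DiffersBy M₂ M₃ b)
    (h₃₄ : D.DiffersBy M₃ M₄ a') (h₄₁ : D.DiffersBy M₄ M₁ b') (hab : a ≠ b) (hab' : a ≠ b') :
    a = a' := by
  have c : G.Coloring Bool := hG.toColoring (by simp)
  obtain ⟨z, hza⟩ := a.2.1.nonempty
  have hz := a.2.1.subset hza
  obtain ⟨l, hl⟩ := D.exists_isEdgeLog hz
  by_contra hne
  -- If `a ≠ a'`, the point `z` of `a` lies in none of the other three labels. The potential is then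
  -- constant on the way round from `M₂` to `M₁`, but changes along the edge `M₁M₂`.
  have k2 := (h₂₃.matchingIncrement_eq_iff c hz hl).2 fun h => hab (FiniteFace.eq_of_mem hza h)
  have k3 := (h₃₄.matchingIncrement_eq_iff c hz hl).2 fun h => hne (FiniteFace.eq_of_mem hza h)
  have k4 := (h₄₁.matchingIncrement_eq_iff c hz hl).2 fun h => hab' (FiniteFace.eq_of_mem hza h)
  exact (h₁₂.matchingIncrement_eq_iff c hz hl).1 (k4.symm.trans (k3.symm.trans k2.symm)) hza

end PlaneDrawing

/-! ### The boundary edges of a face -/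

namespace PlaneDrawing

variable {D : PlaneDrawing G}

/-- The edges on the boundary of the face `s`. -/
def boundary (D : PlaneDrawing G) (s : D.FiniteFace) : Set (Sym2 V) :=
  {e | ∃ h : e ∈ G.edgeSet, ∀ t, D.curve ⟨e, h⟩ t ∈ frontier s.1}

/-- The periphery of `s` is a cycle. -/
def IsCycleFace (D : PlaneDrawing G) (s : D.FiniteFace) : Prop :=
  ∃ (v : V) (w : G.Walk v v), D.IsPeripheryCycle s w

theorem boundary_subset (s : D.FiniteFace) : D.boundary s ⊆ G.edgeSet := fun _ h => h.1

theorem IsPeripheryCycle.boundary_eq {s : D.FiniteFace} {v : V} {w : G.Walk v v}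
    (hw : D.IsPeripheryCycle s w) : D.boundary s = {e | e ∈ w.edges} := by
  ext e
  constructor
  · rintro ⟨he, h⟩
    -- An interior point of an arc lies on no other arc, so it identifies the edge.
    let t₀ : unitInterval := ⟨1 / 2, by norm_num, by norm_num⟩
    have h1 := h t₀
    rw [hw.2] at h1
    obtain ⟨e', he', t, ht⟩ := D.mem_trace.1 h1
    by_cases hee : (⟨e, he⟩ : G.edgeSet) = e'
    · rw [← hee] at he'
      exact he'
    · rcases D.curve_avoids_curves _ e' hee t₀ t ht.symm with h0 | h0 <;>
        · have := congrArg Subtype.val h0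
          norm_num [t₀] at this
  · intro he
    refine ⟨w.edges_subset_edgeSet he, fun t => ?_⟩
    rw [hw.2]
    exact D.curve_mem_trace he t

theorem IsCycleFace.onFace_iff {s : D.FiniteFace} (hs : D.IsCycleFace s) {v : V} :
    D.OnFace v s ↔ ∃ u, s(v, u) ∈ D.boundary s := by
  obtain ⟨x, w, hw⟩ := hs
  rw [OnFace, hw.boundary_eq, hw.2]
  constructor
  · intro h
    obtain ⟨e, he, t, ht⟩ := D.mem_trace.1 h
    obtain ⟨u, hu⟩ := Sym2.mem_iff_exists.1 (D.mem_of_curve_eq_point ht)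
    exact ⟨u, by rw [← hu]; exact he⟩
  · rintro ⟨u, hu⟩
    rcases D.point_eq_of_mem (e := ⟨s(v, u), w.edges_subset_edgeSet hu⟩)
      (Sym2.mem_mk_left v u) with h | h <;> rw [h] <;> exact D.curve_mem_trace hu _

theorem IsCycleFace.nonempty {s : D.FiniteFace} (hs : D.IsCycleFace s) :
    (D.boundary s).Nonempty := by
  obtain ⟨x, w, hw⟩ := hs
  rw [hw.boundary_eq]
  have h3 := hw.1.three_le_length
  rw [← SimpleGraph.Walk.length_edges] at h3
  exact List.exists_mem_of_length_pos (by omega : 0 < w.edges.length)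

theorem IsCycleFace.exists_other {s : D.FiniteFace} (hs : D.IsCycleFace s) {v a : V}
    (h : s(v, a) ∈ D.boundary s) :
    ∃ b, a ≠ b ∧ ∀ u, s(v, u) ∈ D.boundary s ↔ u = a ∨ u = b := by
  obtain ⟨x, w, hw⟩ := hs
  rw [hw.boundary_eq] at h ⊢
  have key : ∀ u, w.toSubgraph.spanningCoe.Adj v u ↔ s(v, u) ∈ w.edges := fun u => by
    simp [SimpleGraph.Walk.adj_toSubgraph_iff_mem_edges]
  obtain ⟨b, ⟨hab, hb⟩, hu⟩ :=
    hw.1.isCycles_spanningCoe_toSubgraph.existsUnique_ne_adj ((key a).2 h)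
  refine ⟨b, hab, fun u => ⟨fun h' => ?_, ?_⟩⟩
  · by_cases hua : u = a
    · exact Or.inl hua
    · exact Or.inr (hu u ⟨Ne.symm hua, (key u).2 h'⟩)
  · rintro (rfl | rfl)
    · exact h
    · exact (key _).1 hb

theorem _root_.SimpleGraph.Walk.mem_of_forall_mem_edges {u v : V} (p : G.Walk u v) {X : Set V}
    (hX : ∀ a b, s(a, b) ∈ p.edges → a ∈ X → b ∈ X) (hu : u ∈ X) {x : V} (hx : x ∈ p.support) :
    x ∈ X := by
  induction p with
  | nil => simp_all
  | cons hadj p ih =>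
    rw [SimpleGraph.Walk.support_cons, List.mem_cons] at hx
    rcases hx with rfl | hx
    · exact hu
    · exact ih (fun a b h => hX a b (by simp [h])) (hX _ _ (by simp) hu) hx

/-- Connectedness of the periphery: local arguments at one vertex spread around the whole cycle. -/
theorem IsCycleFace.mem_of_onFace {s : D.FiniteFace} (hs : D.IsCycleFace s) {X : Set V}
    (hX : ∀ a b, s(a, b) ∈ D.boundary s → a ∈ X → b ∈ X) {a b : V} (ha : D.OnFace a s)
    (hb : D.OnFace b s) (haX : a ∈ X) : b ∈ X := by
  classical
  obtain ⟨u, hu⟩ := hs.onFace_iff.1 ha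
  obtain ⟨u', hu'⟩ := hs.onFace_iff.1 hb
  obtain ⟨x, w, hw⟩ := hs
  rw [hw.boundary_eq] at hX hu hu'
  have ha' := w.fst_mem_support_of_mem_edges hu
  refine (w.rotate a ha').mem_of_forall_mem_edges (fun c d h => hX c d ?_) haX ?_
  · exact (w.rotate_edges a ha').mem_iff.1 h
  · rw [SimpleGraph.Walk.mem_support_rotate_iff]
    exact w.fst_mem_support_of_mem_edges hu'

/-! ### Resonance in terms of boundary edges -/

theorem isResonantFace_iff {M : G.Subgraph} (hM : M.IsPerfectMatching) {s : D.FiniteFace} :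
    D.IsResonantFace M s ↔
      D.IsCycleFace s ∧ ∀ v, D.OnFace v s → ∃ u, M.Adj v u ∧ s(v, u) ∈ D.boundary s := by
  constructor
  · rintro ⟨x, w, hw, halt⟩
    have hs : D.IsCycleFace s := ⟨x, w, hw⟩
    refine ⟨hs, fun v hv => ?_⟩
    obtain ⟨a, ha⟩ := hs.onFace_iff.1 hv
    obtain ⟨b, hab, h⟩ := hs.exists_other ha
    have hb := (h b).2 (Or.inr rfl)
    have key : ∀ u, w.toSubgraph.spanningCoe.Adj v u ↔ s(v, u) ∈ D.boundary s := fun u => by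
      simp [SimpleGraph.Walk.adj_toSubgraph_iff_mem_edges, hw.boundary_eq]
    have := halt hab ((key a).2 ha) ((key b).2 hb)
    by_cases hMa : M.Adj v a
    · exact ⟨a, hMa, ha⟩
    · refine ⟨b, ?_, hb⟩
      by_contra hMb
      exact hMa (this.2 hMb)
  · rintro ⟨hs, h⟩
    obtain ⟨x, w, hw⟩ := id hs
    refine ⟨x, w, hw, fun v a b hab ha hb => ?_⟩
    have key : ∀ u, w.toSubgraph.spanningCoe.Adj v u ↔ s(v, u) ∈ D.boundary s := fun u => by
      simp [SimpleGraph.Walk.adj_toSubgraph_iff_mem_edges, hw.boundary_eq]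
    rw [key] at ha hb
    obtain ⟨u, hMu, hu⟩ := h v (hs.onFace_iff.2 ⟨a, ha⟩)
    obtain ⟨b', hab', hiff⟩ := hs.exists_other ha
    have hb' : b = b' := ((hiff b).1 hb).resolve_left hab.symm
    subst hb'
    simp only [SimpleGraph.Subgraph.spanningCoe_adj]
    constructor
    · intro h1 h2
      exact hab (hM.1.eq_of_adj_left h1 h2)
    · intro h2
      rcases (hiff u).1 hu with rfl | rfl
      · exact hMu
      · exact absurd hMu h2

theorem differsBy_iff {M₁ M₂ : PerfectMatching G} {s : D.FiniteFace} :
    D.DiffersBy M₁ M₂ s ↔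
      D.IsCycleFace s ∧ symmDiff M₁.1.edgeSet M₂.1.edgeSet = D.boundary s := by
  constructor
  · rintro ⟨x, w, hw, h⟩
    exact ⟨⟨x, w, hw⟩, by rw [h, hw.boundary_eq]⟩
  · rintro ⟨⟨x, w, hw⟩, h⟩
    exact ⟨x, w, hw, by rw [h, hw.boundary_eq]⟩

end PlaneDrawing

/-! ### Perfect matchings and flips of alternating cycles. -/

theorem PerfectMatching.ext {M₁ M₂ : PerfectMatching G} (h : M₁.1.edgeSet = M₂.1.edgeSet) :
    M₁ = M₂ :=
  Subtype.ext (SimpleGraph.Subgraph.IsMatching.injOn_edgeSet M₁.2.1 M₂.2.1 h)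

theorem PerfectMatching.exists_adj (M : PerfectMatching G) (v : V) : ∃ u, M.1.Adj v u :=
  (SimpleGraph.Subgraph.isPerfectMatching_iff.1 M.2 v).exists

/-- The symmetric difference of a perfect matching with a set of vertex disjoint alternating
cycles is a perfect matching. -/
theorem PerfectMatching.exists_edgeSet_eq_symmDiff (M : PerfectMatching G) {C : Set (Sym2 V)}
    (hC : C ⊆ G.edgeSet) (h : ∀ v a, s(v, a) ∈ C →
      ∃ x y, M.1.Adj v x ∧ x ≠ y ∧ ∀ u, s(v, u) ∈ C ↔ u = x ∨ u = y) :
    ∃ M' : PerfectMatching G, M'.1.edgeSet = symmDiff M.1.edgeSet C := by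
  have hsub : ∀ e ∈ symmDiff M.1.edgeSet C, e ∈ G.edgeSet := by
    rintro e (⟨h, -⟩ | ⟨h, -⟩)
    · exact M.1.edgeSet_subset h
    · exact hC h
  let M' : G.Subgraph :=
    { verts := univ
      Adj := fun a b => s(a, b) ∈ symmDiff M.1.edgeSet C
      adj_sub := fun h => hsub _ h
      edge_vert := fun _ => mem_univ _
      symm := ⟨fun a b h => by rwa [Sym2.eq_swap]⟩ }
  have hM' : M'.IsPerfectMatching := by
    rw [SimpleGraph.Subgraph.isPerfectMatching_iff]
    intro v
    obtain ⟨z, hz⟩ := M.exists_adj v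
    by_cases hv : ∃ a, s(v, a) ∈ C
    · obtain ⟨a, ha⟩ := hv
      obtain ⟨x, y, hx, hxy, hiff⟩ := h v a ha
      refine ⟨y, Or.inr ⟨(hiff y).2 (Or.inr rfl), fun hy => ?_⟩, ?_⟩
      · exact hxy (M.2.1.eq_of_adj_left hx hy)
      · rintro u (⟨h1, h2⟩ | ⟨h1, h2⟩)
        · exact absurd ((hiff u).2 (Or.inl (M.2.1.eq_of_adj_left h1 hx))) h2
        · refine ((hiff u).1 h1).resolve_left ?_
          rintro rfl
          exact h2 hx
    · refine ⟨z, Or.inl ⟨hz, fun h => hv ⟨z, h⟩⟩, ?_⟩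
      rintro u (⟨h1, h2⟩ | ⟨h1, h2⟩)
      · exact M.2.1.eq_of_adj_left h1 hz
      · exact absurd ⟨u, h1⟩ hv
  refine ⟨⟨M', hM'⟩, ?_⟩
  ext e
  induction e with
  | _ a b => rfl

namespace PlaneDrawing

variable {D : PlaneDrawing G}

theorem DiffersBy.isResonantFace {M₁ M₂ : PerfectMatching G} {s : D.FiniteFace}
    (h : D.DiffersBy M₁ M₂ s) : D.IsResonantFace M₁.1 s := by
  obtain ⟨hs, h⟩ := differsBy_iff.1 h
  refine (isResonantFace_iff M₁.2).2 ⟨hs, fun v hv => ?_⟩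
  obtain ⟨a, ha⟩ := hs.onFace_iff.1 hv
  obtain ⟨b, hab, hiff⟩ := hs.exists_other ha
  have hb := (hiff b).2 (Or.inr rfl)
  have ha' := ha
  have hb' := hb
  rw [← h] at ha' hb'
  rcases ha' with ⟨h1, -⟩ | ⟨h1, -⟩
  · exact ⟨a, h1, ha⟩
  · rcases hb' with ⟨h2, -⟩ | ⟨h2, -⟩
    · exact ⟨b, h2, hb⟩
    · exact absurd (M₂.2.1.eq_of_adj_left h1 h2) hab

theorem boundary_subset_of_common {s t : D.FiniteFace} (hs : D.IsCycleFace s)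
    (ht : D.IsCycleFace t)
    (h : ∀ v, D.OnFace v s → D.OnFace v t → ∀ u, s(v, u) ∈ D.boundary s → s(v, u) ∈ D.boundary t)
    {v : V} (hvs : D.OnFace v s) (hvt : D.OnFace v t) : D.boundary s ⊆ D.boundary t := by
  have key : ∀ b, D.OnFace b s → D.OnFace b t := fun b hb =>
    hs.mem_of_onFace (X := {x | D.OnFace x t}) (fun c d hcd hc => by
      have := h c (hs.onFace_iff.2 ⟨d, hcd⟩) hc d hcd
      exact ht.onFace_iff.2 ⟨c, by rwa [Sym2.eq_swap]⟩) hvs hb hvt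
  intro e he
  induction e with
  | _ a b =>
    have ha : D.OnFace a s := hs.onFace_iff.2 ⟨b, he⟩
    exact h a ha (key a ha) b he

theorem DiffersBy.eq_of_same_label {M M₁ M₂ : PerfectMatching G} {s : D.FiniteFace}
    (h₁ : D.DiffersBy M M₁ s) (h₂ : D.DiffersBy M M₂ s) : M₁ = M₂ :=
  PerfectMatching.ext (symmDiff_right_injective M.1.edgeSet
    ((differsBy_iff.1 h₁).2.trans (differsBy_iff.1 h₂).2.symm))

/-- Distinct resonant faces `s` and `t` share no vertex if `s` stays resonant after flipping `t`. -/
theorem DiffersBy.not_onFace_and_onFace [Finite V] (hG : G.IsBipartite)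
    {M₁ M₂ M₃ : PerfectMatching G} {s t : D.FiniteFace} (hs : D.DiffersBy M₁ M₂ s)
    (ht : D.DiffersBy M₁ M₃ t) (hs₃ : D.IsResonantFace M₃.1 s) (hst : s ≠ t) (v : V) :
    ¬ (D.OnFace v s ∧ D.OnFace v t) := by
  rintro ⟨hvs, hvt⟩
  obtain ⟨cs, hs1⟩ := (isResonantFace_iff M₁.2).1 hs.isResonantFace
  obtain ⟨ct, ht1⟩ := (isResonantFace_iff M₁.2).1 ht.isResonantFace
  obtain ⟨-, hs3⟩ := (isResonantFace_iff M₃.2).1 hs₃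
  obtain ⟨-, ht3⟩ := (isResonantFace_iff M₃.2).1 ht.symm.isResonantFace
  have htd := (differsBy_iff.1 ht).2
  -- At a common vertex the `M₁`-edge and the `M₃`-edge lie on both peripheries, and they differ
  -- because `t` was flipped. They are thus the two boundary edges of each face, so the peripheries
  -- coincide, against uniqueness of labels.
  have key : ∀ x, D.OnFace x s → D.OnFace x t →
      ∀ u, s(x, u) ∈ D.boundary s ↔ s(x, u) ∈ D.boundary t := by
    intro x hxs hxt u
    obtain ⟨a, ha, has⟩ := hs1 x hxs
    obtain ⟨a', ha', hat⟩ := ht1 x hxt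
    obtain rfl := M₁.2.1.eq_of_adj_left ha ha'
    obtain ⟨b, hb, hbs⟩ := hs3 x hxs
    obtain ⟨b', hb', hbt⟩ := ht3 x hxt
    obtain rfl := M₃.2.1.eq_of_adj_left hb hb'
    have hab : a ≠ b := by
      rintro rfl
      rw [← htd] at hat
      rcases hat with ⟨-, h⟩ | ⟨-, h⟩
      · exact h hb
      · exact h ha
    obtain ⟨y, -, h1⟩ := cs.exists_other has
    obtain ⟨z, -, h2⟩ := ct.exists_other hat
    obtain rfl := ((h1 b).1 hbs).resolve_left hab.symm
    obtain rfl := ((h2 b).1 hbt).resolve_left hab.symm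
    rw [h1, h2]
  have hbd : D.boundary s = D.boundary t :=
    Subset.antisymm
      (boundary_subset_of_common cs ct (fun x h h' u => (key x h h' u).1) hvs hvt)
      (boundary_subset_of_common ct cs (fun x h h' u => (key x h' h u).2) hvt hvs)
  refine hst (DiffersBy.label_unique hG hs (differsBy_iff.2 ⟨ct, ?_⟩))
  rw [(differsBy_iff.1 hs).2, hbd]

/-- Two perfect matchings for which `s` is resonant and which share an edge of the boundary of
`s` coincide on this boundary. -/
theorem boundary_inter_subset_of_common {M₁ M₂ : PerfectMatching G} {s : D.FiniteFace}
    (h₁ : D.IsResonantFace M₁.1 s) (h₂ : D.IsResonantFace M₂.1 s) {e₀ : Sym2 V}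
    (he₀ : e₀ ∈ D.boundary s) (he₁ : e₀ ∈ M₁.1.edgeSet) (he₂ : e₀ ∈ M₂.1.edgeSet) :
    D.boundary s ∩ M₁.1.edgeSet ⊆ M₂.1.edgeSet := by
  obtain ⟨hs, h1⟩ := (isResonantFace_iff M₁.2).1 h₁
  obtain ⟨-, h2⟩ := (isResonantFace_iff M₂.2).1 h₂
  induction e₀ with
  | _ p q =>
    -- Agreement passes along a boundary edge `cd`: either `cd` is the common matching edge, or both
    -- matchings must use the other boundary edge at `d`.
    have key : ∀ b, D.OnFace b s → ∃ u, M₁.1.Adj b u ∧ M₂.1.Adj b u := fun b hb =>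
      hs.mem_of_onFace (X := {x | ∃ u, M₁.1.Adj x u ∧ M₂.1.Adj x u}) (fun c d hcd hc => by
        obtain ⟨u, hu1, hu2⟩ := hc
        by_cases hud : u = d
        · subst hud
          exact ⟨c, hu1.symm, hu2.symm⟩
        · have hdc : s(d, c) ∈ D.boundary s := by rwa [Sym2.eq_swap]
          have hd : D.OnFace d s := hs.onFace_iff.2 ⟨c, hdc⟩
          obtain ⟨x, hx1, hx⟩ := h1 d hd
          obtain ⟨y, hy2, hy⟩ := h2 d hd
          obtain ⟨z, -, hz⟩ := hs.exists_other hdc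
          have hxc : x ≠ c := by
            rintro rfl
            exact hud (M₁.2.1.eq_of_adj_left hu1 hx1.symm)
          have hyc : y ≠ c := by
            rintro rfl
            exact hud (M₂.2.1.eq_of_adj_left hu2 hy2.symm)
          have e1 := ((hz x).1 hx).resolve_left hxc
          have e2 := ((hz y).1 hy).resolve_left hyc
          subst e1
          subst e2
          exact ⟨_, hx1, hy2⟩) (hs.onFace_iff.2 ⟨q, he₀⟩) hb ⟨q, he₁, he₂⟩
    rintro e ⟨he, heM⟩
    induction e with
    | _ a b =>
      obtain ⟨u, hu1, hu2⟩ := key a (hs.onFace_iff.2 ⟨b, he⟩)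
      rw [SimpleGraph.Subgraph.mem_edgeSet] at heM ⊢
      rwa [M₁.2.1.eq_of_adj_left heM hu1]

end PlaneDrawing

/-! ### Hypercubes -/

/-- The neighbour of the vertex `x` of the hypercube in direction `i`. -/
def flip {k : ℕ} (i : Fin k) (x : Fin k → Bool) : Fin k → Bool := Function.update x i (!x i)

section flip

variable {k : ℕ}

@[simp] theorem flip_self (i : Fin k) (x : Fin k → Bool) : flip i x i = !x i := by simp [flip]

theorem flip_of_ne {i j : Fin k} (h : j ≠ i) (x : Fin k → Bool) : flip i x j = x j := by
  simp [flip, h]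

@[simp] theorem flip_flip (i : Fin k) (x : Fin k → Bool) : flip i (flip i x) = x := by
  simp [flip]

theorem flip_comm (i j : Fin k) (x : Fin k → Bool) : flip i (flip j x) = flip j (flip i x) := by
  funext l
  by_cases hij : i = j
  · rw [hij]
  · by_cases hi : l = i
    · subst hi
      rw [flip_self, flip_of_ne hij, flip_of_ne hij, flip_self]
    · rw [flip_of_ne hi]
      by_cases hj : l = j
      · subst hj
        rw [flip_self, flip_self, flip_of_ne hi]
      · rw [flip_of_ne hj, flip_of_ne hj, flip_of_ne hi]

theorem flip_left_injective (x : Fin k → Bool) : Function.Injective fun i => flip i x := by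
  intro i j h
  by_contra hij
  have := congrFun h i
  simp [flip_of_ne hij] at this

theorem hypercube_adj_iff {x y : Fin k → Bool} : (hypercube k).Adj x y ↔ ∃ i, y = flip i x := by
  constructor
  · rintro ⟨i, hi, h⟩
    refine ⟨i, funext fun j => ?_⟩
    by_cases hj : j = i
    · subst hj
      rw [flip_self]
      cases hx : x j <;> cases hy : y j <;> simp_all
    · rw [flip_of_ne hj, h j hj]
  · rintro ⟨i, rfl⟩
    refine ⟨i, by simp, fun j hj => (flip_of_ne hj x).symm⟩

theorem hammingDist_flip_add_one {x y : Fin k → Bool} {i : Fin k} (hi : x i ≠ y i) :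
    hammingDist (flip i x) y + 1 = hammingDist x y := by
  have h1 : ({j | x j ≠ y j} : Finset (Fin k)) =
      insert i ({j | flip i x j ≠ y j} : Finset (Fin k)) := by
    ext j
    by_cases hj : j = i
    · subst hj
      simpa using hi
    · simp [flip_of_ne hj, hj]
  have h2 : i ∉ ({j | flip i x j ≠ y j} : Finset (Fin k)) := by
    cases hx : x i <;> cases hy : y i <;> simp_all
  unfold hammingDist
  rw [h1, Finset.card_insert_of_notMem h2]

theorem exists_ne_of_hammingDist {x y : Fin k → Bool} {n : ℕ} (hn : hammingDist x y = n + 1) :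
    ∃ i, x i ≠ y i := by
  by_contra! hall
  rw [funext hall, hammingDist_self] at hn
  omega

/-- A property preserved by all flips holds everywhere if it holds somewhere. -/
theorem flip_induction {p : (Fin k → Bool) → Prop} {x : Fin k → Bool} (hx : p x)
    (h : ∀ i y, p y → p (flip i y)) (y : Fin k → Bool) : p y := by
  induction hn : hammingDist y x generalizing y with
  | zero => rwa [eq_of_hammingDist_eq_zero hn]
  | succ n ih =>
    obtain ⟨i, hi⟩ := exists_ne_of_hammingDist hn
    have hfl := hammingDist_flip_add_one hi
    have := h i _ (ih (flip i y) (by omega))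
    rwa [flip_flip] at this

end flip

/-! ### Distances and the relation Θ in a hypercube. -/

section dist

variable {W : Type*} {H : SimpleGraph W} {k : ℕ}

theorem hammingDist_le_length (φ : H ≃g hypercube k) {a b : W} (p : H.Walk a b) :
    hammingDist (φ a) (φ b) ≤ p.length := by
  induction p with
  | nil => simp
  | @cons a c b hadj p ih =>
    have h1 := hammingDist_triangle (φ a) (φ c) (φ b)
    obtain ⟨i, hi⟩ := hypercube_adj_iff.1 (φ.map_adj_iff.2 hadj)
    have h2 : hammingDist (φ a) (φ c) ≤ 1 := by
      unfold hammingDist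
      refine (Finset.card_le_card (t := {i}) fun j hj => ?_).trans_eq (Finset.card_singleton i)
      by_contra hji
      rw [Finset.mem_singleton] at hji
      simp [hi, flip_of_ne hji] at hj
    rw [SimpleGraph.Walk.length_cons]
    omega

theorem exists_walk_length_eq_hammingDist (φ : H ≃g hypercube k) (a b : W) :
    ∃ p : H.Walk a b, p.length = hammingDist (φ a) (φ b) := by
  induction hn : hammingDist (φ a) (φ b) generalizing a with
  | zero =>
    obtain rfl := φ.injective (eq_of_hammingDist_eq_zero hn)
    exact ⟨.nil, rfl⟩
  | succ n ih =>
    obtain ⟨i, hi⟩ := exists_ne_of_hammingDist hn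
    have hadj : H.Adj a (φ.symm (flip i (φ a))) := by
      rw [← φ.map_adj_iff, hypercube_adj_iff]
      exact ⟨i, by simp⟩
    have hfl : hammingDist (φ (φ.symm (flip i (φ a)))) (φ b) = n := by
      have := hammingDist_flip_add_one hi
      rw [φ.apply_symm_apply]
      omega
    obtain ⟨p, hp⟩ := ih _ hfl
    exact ⟨.cons hadj p, by rw [SimpleGraph.Walk.length_cons, hp]⟩

theorem dist_eq_hammingDist (φ : H ≃g hypercube k) (a b : W) :
    H.dist a b = hammingDist (φ a) (φ b) := by
  obtain ⟨p, hp⟩ := exists_walk_length_eq_hammingDist φ a b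
  obtain ⟨q, hq⟩ := p.reachable.exists_walk_length_eq_dist
  refine le_antisymm (hp ▸ SimpleGraph.dist_le p) ?_
  rw [← hq]
  exact hammingDist_le_length φ q

theorem theta_self {e : Sym2 W} (he : e ∈ H.edgeSet) : Theta H e e := by
  induction e with
  | _ a b =>
    refine ⟨a, b, a, b, rfl, rfl, ?_⟩
    have h1 : H.dist a b = 1 := SimpleGraph.dist_eq_one_iff_adj.2 he
    have h2 : H.dist b a = 1 := SimpleGraph.dist_eq_one_iff_adj.2 (H.adj_symm he)
    simp [h1, h2]

/-- Each coordinate is touched by at most one of the two flips, so equality holds coordinate by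
coordinate. Hence edges in different directions are not in relation Θ. -/
theorem hammingDist_add_flip (x y : Fin k → Bool) {i j : Fin k} (hij : i ≠ j) :
    hammingDist x y + hammingDist (flip i x) (flip j y) =
      hammingDist x (flip j y) + hammingDist (flip i x) y := by
  simp only [hammingDist, Finset.card_filter, ← Finset.sum_add_distrib]
  refine Finset.sum_congr rfl fun l _ => ?_
  by_cases hl : l = i
  · subst hl
    rw [flip_of_ne hij]
  · rw [flip_of_ne hl]
    omega

/-- The edges of `H` in direction `i`. -/
def IsDirection (φ : H ≃g hypercube k) (i : Fin k) (e : Sym2 W) : Prop :=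
  ∀ a b, e = s(a, b) → φ b = flip i (φ a)

theorem isDirection_mk (φ : H ≃g hypercube k) {i : Fin k} {a b : W} :
    IsDirection φ i s(a, b) ↔ φ b = flip i (φ a) := by
  refine ⟨fun h => h a b rfl, fun h c d hcd => ?_⟩
  rcases Sym2.eq_iff.1 hcd with ⟨rfl, rfl⟩ | ⟨rfl, rfl⟩
  · exact h
  · rw [h, flip_flip]

theorem exists_isDirection (φ : H ≃g hypercube k) {e : Sym2 W} (he : e ∈ H.edgeSet) :
    ∃ i, IsDirection φ i e := by
  induction e with
  | _ a b =>
    obtain ⟨i, hi⟩ := hypercube_adj_iff.1 (φ.map_adj_iff.2 he)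
    exact ⟨i, (isDirection_mk φ).2 hi⟩

theorem Theta.isDirection (φ : H ≃g hypercube k) {e e' : Sym2 W} (h : Theta H e e')
    (he' : e' ∈ H.edgeSet) {i : Fin k} (hi : IsDirection φ i e) : IsDirection φ i e' := by
  obtain ⟨j, hj⟩ := exists_isDirection φ he'
  obtain ⟨a, b, c, d, rfl, rfl, h⟩ := h
  rw [isDirection_mk] at hi hj
  by_cases hij : i = j
  · rw [hij, isDirection_mk, hj]
  · refine absurd ?_ h
    rw [dist_eq_hammingDist φ, dist_eq_hammingDist φ, dist_eq_hammingDist φ,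
      dist_eq_hammingDist φ, hi, hj]
    exact hammingDist_add_flip _ _ hij

theorem IsThetaClass.exists_isDirection (φ : H ≃g hypercube k) {c : Set (Sym2 W)}
    (hc : IsThetaClass H c) : c.Nonempty ∧ ∃ i, ∀ e ∈ c, IsDirection φ i e := by
  obtain ⟨e, he, rfl⟩ := hc
  obtain ⟨i, hi⟩ := PlaneResonance.exists_isDirection φ he
  exact ⟨⟨e, he, theta_self he⟩, i, fun e' he' => he'.2.isDirection φ he'.1 hi⟩

theorem exists_isThetaClass (φ : H ≃g hypercube k) (i : Fin k) :
    ∃ c, IsThetaClass H c ∧ c.Nonempty ∧ ∀ e ∈ c, IsDirection φ i e := by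
  have hdir : IsDirection φ i s(φ.symm fun _ => false, φ.symm (flip i fun _ => false)) := by
    rw [isDirection_mk]
    simp
  have he : s(φ.symm fun _ => false, φ.symm (flip i fun _ => false)) ∈ H.edgeSet := by
    rw [SimpleGraph.mem_edgeSet, φ.symm.map_adj_iff, hypercube_adj_iff]
    exact ⟨i, rfl⟩
  exact ⟨_, ⟨_, he, rfl⟩, ⟨_, he, theta_self he⟩, fun e' he' => he'.2.isDirection φ he'.1 hdir⟩

end dist

/-! ### Hypercubes of the resonance graph -/

namespace PlaneDrawing

variable {D : PlaneDrawing G} {k : ℕ} {Q : D.resonanceGraph.Subgraph}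

/-- The face `l i` is the face-label of all edges of the hypercube in direction `i`. -/
def IsLabelling (φ : Q.coe ≃g hypercube k) (l : Fin k → D.FiniteFace) : Prop :=
  ∀ x i, D.DiffersBy (φ.symm x).1 (φ.symm (flip i x)).1 (l i)

/-- In a square spanned by directions `i ≠ j`, adjacent edges have different labels, since a label
and one end determine the other end. The opposite-label lemma then carries the label of direction
`i` across every flip. -/
theorem exists_isLabelling [Finite V] (hG : G.IsBipartite) (φ : Q.coe ≃g hypercube k) :
    ∃ l, IsLabelling φ l := by
  have hinj : ∀ x y, (φ.symm x).1 = (φ.symm y).1 → x = y := fun x y h =>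
    φ.symm.injective (Subtype.ext h)
  have hadj : ∀ x i, ∃ s, D.DiffersBy (φ.symm x).1 (φ.symm (flip i x)).1 s := fun x i =>
    Q.adj_sub (φ.symm.map_adj_iff.2 (hypercube_adj_iff.2 ⟨i, rfl⟩) : Q.coe.Adj _ _)
  choose lab hlab using hadj
  have hsq : ∀ i j x, lab (flip j x) i = lab x i := by
    intro i j x
    by_cases hij : i = j
    · subst hij
      have := hlab (flip i x) i
      rw [flip_flip] at this
      exact DiffersBy.label_unique hG this.symm (hlab x i)
    · have h23 := hlab (flip i x) j
      have h34 := (hlab (flip j x) i).symm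
      rw [flip_comm] at h34
      refine (DiffersBy.label_opposite hG (hlab x i) h23 h34 (hlab x j).symm ?_ ?_).symm
      · intro h
        rw [← h] at h23
        have h1 := hinj _ _ ((hlab x i).symm.eq_of_same_label h23)
        have h2 := congrFun h1 i
        rw [flip_of_ne hij, flip_self] at h2
        simp at h2
      · intro h
        have h14 := hlab x j
        rw [← h] at h14
        exact hij (flip_left_injective x (hinj _ _ ((hlab x i).eq_of_same_label h14)))
  refine ⟨fun i => lab (fun _ => false) i, fun x i => ?_⟩
  have : lab x i = lab (fun _ => false) i :=
    flip_induction (p := fun y => lab y i = lab (fun _ => false) i) rfl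
      (fun j y hy => (hsq i j y).trans hy) x
  simpa only [this] using hlab x i

variable {φ : Q.coe ≃g hypercube k} {l : Fin k → D.FiniteFace}

theorem IsLabelling.differsBy (hl : IsLabelling φ l) {a b : Q.verts} {i : Fin k}
    (h : φ b = flip i (φ a)) : D.DiffersBy a.1 b.1 (l i) := by
  have := hl (φ a) i
  rwa [← h, φ.symm_apply_apply, φ.symm_apply_apply] at this

theorem IsLabelling.injective (hl : IsLabelling φ l) : Function.Injective l := by
  intro i j hij
  have h1 := hl (fun _ => false) i
  rw [hij] at h1
  exact flip_left_injective _ (φ.symm.injective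
    (Subtype.ext (h1.eq_of_same_label (hl (fun _ => false) j))))

theorem IsLabelling.isResonantFace (hl : IsLabelling φ l) {M : PerfectMatching G}
    (hM : M ∈ Q.verts) (i : Fin k) : D.IsResonantFace M.1 (l i) :=
  (hl.differsBy (a := ⟨M, hM⟩) (b := φ.symm (flip i (φ ⟨M, hM⟩))) (i := i)
    (by simp)).isResonantFace

theorem IsLabelling.isResonantSet [Finite V] (hG : G.IsBipartite) (hl : IsLabelling φ l) :
    D.IsResonantSet (range l) := by
  let M := (φ.symm fun _ => false).1
  refine ⟨?_, M.1, M.2, ?_⟩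
  · rintro _ ⟨i, rfl⟩ _ ⟨j, rfl⟩ hij v
    exact (hl (fun _ => false) i).not_onFace_and_onFace hG (hl (fun _ => false) j)
      (hl.isResonantFace (φ.symm _).2 i) hij v
  · rintro _ ⟨i, rfl⟩
    exact hl.isResonantFace (φ.symm _).2 i

theorem IsLabelling.isFaceLabel (hl : IsLabelling φ l) {c : Set (Sym2 Q.verts)} {i : Fin k}
    (hc : ∀ e ∈ c, IsDirection φ i e) : D.IsFaceLabel Q c (l i) := fun _ _ h =>
  hl.differsBy ((isDirection_mk φ).1 (hc _ h))

theorem IsFaceLabel.unique [Finite V] (hG : G.IsBipartite) {c : Set (Sym2 Q.verts)}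
    (hc : c.Nonempty) {s t : D.FiniteFace} (hs : D.IsFaceLabel Q c s)
    (ht : D.IsFaceLabel Q c t) : s = t := by
  obtain ⟨e, he⟩ := hc
  induction e with
  | _ a b => exact DiffersBy.label_unique hG (hs a b he) (ht a b he)

theorem IsLabelling.faceLabels_eq [Finite V] (hG : G.IsBipartite) (hl : IsLabelling φ l) :
    D.faceLabels Q = range l := by
  ext s
  constructor
  · rintro ⟨c, hc, hs⟩
    obtain ⟨hne, i, hi⟩ := hc.exists_isDirection φ
    exact ⟨i, (hl.isFaceLabel hi).unique hG hne hs⟩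
  · rintro ⟨i, rfl⟩
    obtain ⟨c, hc, -, hi⟩ := exists_isThetaClass φ i
    exact ⟨c, hc, hl.isFaceLabel hi⟩

theorem existsUnique_isFaceLabel [Finite V] (hG : G.IsBipartite) (hQ : IsHypercube k Q)
    {c : Set (Sym2 Q.verts)} (hc : IsThetaClass Q.coe c) : ∃! s, D.IsFaceLabel Q c s := by
  obtain ⟨φ⟩ := hQ
  obtain ⟨l, hl⟩ := exists_isLabelling hG φ
  obtain ⟨hne, i, hi⟩ := hc.exists_isDirection φ
  exact ⟨l i, hl.isFaceLabel hi, fun s hs => hs.unique hG hne (hl.isFaceLabel hi)⟩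

theorem encard_faceLabels [Finite V] (hG : G.IsBipartite) (hQ : IsHypercube k Q) :
    (D.faceLabels Q).encard = k := by
  obtain ⟨φ⟩ := hQ
  obtain ⟨l, hl⟩ := exists_isLabelling hG φ
  rw [hl.faceLabels_eq hG, ← image_univ, hl.injective.encard_image]
  simp

theorem isResonantSet_faceLabels [Finite V] (hG : G.IsBipartite) (hQ : IsHypercube k Q) :
    D.IsResonantSet (D.faceLabels Q) := by
  obtain ⟨φ⟩ := hQ
  obtain ⟨l, hl⟩ := exists_isLabelling hG φ
  rw [hl.faceLabels_eq hG]
  exact hl.isResonantSet hG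

theorem isResonantFace_of_mem_faceLabels [Finite V] (hG : G.IsBipartite) (hQ : IsHypercube k Q)
    {s : D.FiniteFace} (hs : s ∈ D.faceLabels Q) {M : PerfectMatching G} (hM : M ∈ Q.verts) :
    D.IsResonantFace M.1 s := by
  obtain ⟨φ⟩ := hQ
  obtain ⟨l, hl⟩ := exists_isLabelling hG φ
  rw [hl.faceLabels_eq hG] at hs
  obtain ⟨i, rfl⟩ := hs
  exact hl.isResonantFace hM i

theorem nonempty_verts (hQ : IsHypercube k Q) : Q.verts.Nonempty := by
  obtain ⟨φ⟩ := hQ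
  exact ⟨_, (φ.symm fun _ => false).2⟩

theorem adj_iff_of_isHypercube [Finite V] (hG : G.IsBipartite) (hQ : IsHypercube k Q)
    {M₁ M₂ : PerfectMatching G} :
    Q.Adj M₁ M₂ ↔ M₁ ∈ Q.verts ∧ ∃ s ∈ D.faceLabels Q, D.DiffersBy M₁ M₂ s := by
  obtain ⟨φ⟩ := hQ
  obtain ⟨l, hl⟩ := exists_isLabelling hG φ
  rw [hl.faceLabels_eq hG]
  constructor
  · intro h
    have hadj : Q.coe.Adj ⟨M₁, Q.edge_vert h⟩ ⟨M₂, Q.edge_vert h.symm⟩ := h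
    obtain ⟨i, hi⟩ := hypercube_adj_iff.1 (φ.map_adj_iff.2 hadj)
    exact ⟨Q.edge_vert h, l i, ⟨i, rfl⟩, hl.differsBy hi⟩
  · rintro ⟨hM, _, ⟨i, rfl⟩, h⟩
    have h' := hl.differsBy (a := ⟨M₁, hM⟩) (b := φ.symm (flip i (φ ⟨M₁, hM⟩))) (i := i) (by simp)
    have hadj : Q.coe.Adj ⟨M₁, hM⟩ (φ.symm (flip i (φ ⟨M₁, hM⟩))) := by
      rw [← φ.map_adj_iff, hypercube_adj_iff]
      exact ⟨i, by simp⟩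
    rw [h.eq_of_same_label h']
    exact hadj

/-- Any property of perfect matchings invariant under flipping the face-labels of a hypercube
holds on the whole hypercube if it holds at one of its vertices. -/
theorem isHypercube_induction [Finite V] (hG : G.IsBipartite) (hQ : IsHypercube k Q)
    {p : PerfectMatching G → Prop} {M : PerfectMatching G} (hM : M ∈ Q.verts) (hp : p M)
    (h : ∀ M₁ M₂, ∀ s ∈ D.faceLabels Q, D.DiffersBy M₁ M₂ s → p M₁ → p M₂)
    {M' : PerfectMatching G} (hM' : M' ∈ Q.verts) : p M' := by
  obtain ⟨φ⟩ := hQ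
  obtain ⟨l, hl⟩ := exists_isLabelling hG φ
  have := flip_induction (p := fun x => p (φ.symm x).1) (x := φ ⟨M, hM⟩) (by simpa using hp)
    (fun i y hy => h _ _ (l i) (by rw [hl.faceLabels_eq hG]; exact ⟨i, rfl⟩) (hl y i) hy)
    (φ ⟨M', hM'⟩)
  simpa using this

/-- A hypercube is determined by one of its vertices and its face-labels. -/
theorem eq_of_faceLabels_eq [Finite V] (hG : G.IsBipartite) {k' : ℕ}
    {Q' : D.resonanceGraph.Subgraph} (hQ : IsHypercube k Q) (hQ' : IsHypercube k' Q')
    (h : D.faceLabels Q = D.faceLabels Q') {M : PerfectMatching G} (hM : M ∈ Q.verts)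
    (hM' : M ∈ Q'.verts) : Q = Q' := by
  have hverts : Q.verts = Q'.verts := by
    apply Subset.antisymm
    · intro M₁ h₁
      refine isHypercube_induction hG hQ (p := fun N => N ∈ Q'.verts) hM hM'
        (fun N₁ N₂ s hs hd hN => ?_) h₁
      exact Q'.edge_vert ((adj_iff_of_isHypercube hG hQ').2 ⟨hN, s, h ▸ hs, hd⟩).symm
    · intro M₁ h₁
      refine isHypercube_induction hG hQ' (p := fun N => N ∈ Q.verts) hM' hM
        (fun N₁ N₂ s hs hd hN => ?_) h₁
      exact Q.edge_vert ((adj_iff_of_isHypercube hG hQ).2 ⟨hN, s, h ▸ hs, hd⟩).symm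
  refine SimpleGraph.Subgraph.ext hverts ?_
  funext M₁ M₂
  rw [adj_iff_of_isHypercube hG hQ, adj_iff_of_isHypercube hG hQ', h, hverts]

/-! ### Construction of hypercubes -/

theorem IsResonantFace.isCycleFace {M : G.Subgraph} {s : D.FiniteFace}
    (h : D.IsResonantFace M s) : D.IsCycleFace s := by
  obtain ⟨v, w, hw, -⟩ := h
  exact ⟨v, w, hw⟩

/-- Choosing a vertex on each face is injective, by disjointness. -/
theorem IsResonantSet.finite [Finite V] {S : Set D.FiniteFace} (hS : D.IsResonantSet S) :
    S.Finite := by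
  obtain ⟨hdis, M, hM, hres⟩ := hS
  have h : ∀ s : S, ∃ v, D.OnFace v s.1 := fun s => by
    have hc := (hres s.1 s.2).isCycleFace
    obtain ⟨e, he⟩ := hc.nonempty
    induction e with
    | _ a b => exact ⟨a, hc.onFace_iff.2 ⟨b, he⟩⟩
  choose v hv using h
  have : Finite S := Finite.of_injective v fun s t hst => by
    by_contra hne
    exact hdis s.1 s.2 t.1 t.2 (fun h => hne (Subtype.ext h)) (v s) ⟨hv s, hst ▸ hv t⟩
  exact toFinite S

/-- The vertex `x` of the cube is `M` with the faces `σ i`, `x i = true`, flipped. Disjointness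
makes the flips independent, and the choice `x = false` gives back `M`. -/
theorem exists_isHypercube [Finite V] (hG : G.IsBipartite) {S : Set D.FiniteFace}
    (hdis : ∀ s ∈ S, ∀ t ∈ S, s ≠ t → ∀ v, ¬ (D.OnFace v s ∧ D.OnFace v t))
    (M : PerfectMatching G) (hres : ∀ s ∈ S, D.IsResonantFace M.1 s) (hk : S.encard = k) :
    ∃ Q : D.resonanceGraph.Subgraph, IsHypercube k Q ∧ D.faceLabels Q = S ∧ M ∈ Q.verts := by
  obtain ⟨σ, hσ, rfl⟩ : ∃ σ : Fin k → D.FiniteFace, Function.Injective σ ∧ range σ = S := by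
    have hfin : S.Finite := finite_of_encard_eq_coe hk
    have : Finite S := hfin
    have hcard : Nat.card S = k := by
      rw [Nat.card_coe_set_eq, ncard_def, hk]
      rfl
    let e := (Finite.equivFinOfCardEq hcard).symm
    refine ⟨fun i => (e i).1, Subtype.val_injective.comp e.injective, ?_⟩
    ext s
    exact ⟨fun ⟨i, hi⟩ => hi ▸ (e i).2, fun hs => ⟨e.symm ⟨s, hs⟩, by simp⟩⟩
  have hcyc : ∀ i, D.IsCycleFace (σ i) := fun i => (hres _ ⟨i, rfl⟩).isCycleFace
  have hone : ∀ i j v a b, s(v, a) ∈ D.boundary (σ i) → s(v, b) ∈ D.boundary (σ j) → i = j := by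
    intro i j v a b hi hj
    by_contra hij
    exact hdis _ ⟨i, rfl⟩ _ ⟨j, rfl⟩ (hσ.ne hij) v
      ⟨(hcyc i).onFace_iff.2 ⟨a, hi⟩, (hcyc j).onFace_iff.2 ⟨b, hj⟩⟩
  have hone' : ∀ i j e, e ∈ D.boundary (σ i) → e ∈ D.boundary (σ j) → i = j := by
    intro i j e
    induction e with
    | _ a b => exact hone i j a b b
  let C : (Fin k → Bool) → Set (Sym2 V) := fun x => {e | ∃ i, x i = true ∧ e ∈ D.boundary (σ i)}
  have hC : ∀ x, ∃ M' : PerfectMatching G, M'.1.edgeSet = symmDiff M.1.edgeSet (C x) := by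
    intro x
    refine M.exists_edgeSet_eq_symmDiff (fun e ⟨i, _, he⟩ => boundary_subset _ he) ?_
    rintro v a ⟨i, hi, ha⟩
    obtain ⟨b, hb, hbs⟩ :=
      ((isResonantFace_iff M.2).1 (hres _ ⟨i, rfl⟩)).2 v ((hcyc i).onFace_iff.2 ⟨a, ha⟩)
    obtain ⟨y, hy, hiff⟩ := (hcyc i).exists_other hbs
    refine ⟨b, y, hb, hy, fun u => ?_⟩
    rw [← hiff]
    constructor
    · rintro ⟨j, -, hu⟩
      rwa [hone i j v a u ha hu]
    · exact fun hu => ⟨i, hi, hu⟩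
  choose m hm using hC
  have hmem : ∀ x i e, e ∈ D.boundary (σ i) → (e ∈ C x ↔ x i = true) := by
    intro x i e he
    constructor
    · rintro ⟨j, hj, he'⟩
      rwa [hone' i j e he he']
    · exact fun h => ⟨i, h, he⟩
  have hinj : Function.Injective m := by
    intro x y hxy
    have hCxy : C x = C y := symmDiff_right_injective M.1.edgeSet (by
      simp only
      rw [← hm x, ← hm y, hxy])
    funext i
    obtain ⟨e, he⟩ := (hcyc i).nonempty
    have h1 := hmem x i e he
    have h2 := hmem y i e he
    rw [hCxy, h2] at h1
    cases hx : x i <;> cases hy : y i <;> simp_all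
  have hdiff : ∀ x i, D.DiffersBy (m x) (m (flip i x)) (σ i) := by
    intro x i
    refine differsBy_iff.2 ⟨hcyc i, ?_⟩
    rw [hm, hm, symmDiff_symmDiff_symmDiff_comm, symmDiff_self, bot_symmDiff]
    ext e
    constructor
    · rintro (⟨⟨j, hj, he⟩, h⟩ | ⟨⟨j, hj, he⟩, h⟩)
      · by_cases hji : j = i
        · rwa [← hji]
        · exact absurd ⟨j, by rwa [flip_of_ne hji], he⟩ h
      · by_cases hji : j = i
        · rwa [← hji]
        · exact absurd ⟨j, by rwa [flip_of_ne hji] at hj, he⟩ h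
    · intro he
      rw [mem_symmDiff, hmem x i e he, hmem _ i e he, flip_self]
      cases x i <;> simp
  let Q : D.resonanceGraph.Subgraph :=
    { verts := range m
      Adj := fun M₁ M₂ => ∃ x i, m x = M₁ ∧ m (flip i x) = M₂
      adj_sub := by
        rintro _ _ ⟨x, i, rfl, rfl⟩
        exact ⟨σ i, hdiff x i⟩
      edge_vert := by
        rintro _ _ ⟨x, i, rfl, rfl⟩
        exact ⟨x, rfl⟩
      symm := ⟨by
        rintro _ _ ⟨x, i, rfl, rfl⟩
        exact ⟨flip i x, i, rfl, by rw [flip_flip]⟩⟩ }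
  let ψ : hypercube k ≃g Q.coe :=
    { toEquiv := Equiv.ofInjective m hinj
      map_rel_iff' := by
        intro x y
        rw [hypercube_adj_iff]
        constructor
        · rintro ⟨x', i, hx, hy⟩
          exact ⟨i, by rw [← hinj hx]; exact (hinj hy).symm⟩
        · rintro ⟨i, rfl⟩
          exact ⟨x, i, rfl, rfl⟩ }
  refine ⟨Q, ⟨ψ.symm⟩, IsLabelling.faceLabels_eq (φ := ψ.symm) hG fun x i => hdiff x i,
    fun _ => false, PerfectMatching.ext ?_⟩
  have : C (fun _ => false) = ∅ := by
    ext e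
    simp [C]
  rw [hm, this]
  simp

end PlaneDrawing

/-! ### Canonical resonant sets -/

namespace PlaneDrawing

variable {D : PlaneDrawing G} {k : ℕ} {Q : D.resonanceGraph.Subgraph} {S : Set D.FiniteFace}

theorem mem_boundary_of_adj {M : PerfectMatching G} {s : D.FiniteFace}
    (hs : D.IsResonantFace M.1 s) {a b : V} (ha : D.OnFace a s) (hab : M.1.Adj a b) :
    s(a, b) ∈ D.boundary s := by
  obtain ⟨u, hu, hus⟩ := ((isResonantFace_iff M.2).1 hs).2 a ha
  rwa [M.2.1.eq_of_adj_left hab hu]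

theorem mem_remaining_of_adj {M : PerfectMatching G} (hM : ∀ s ∈ S, D.IsResonantFace M.1 s)
    {a b : V} (hab : M.1.Adj a b) (ha : a ∈ D.remaining S) : b ∈ D.remaining S := fun s hs hb =>
  ha s hs ((hM s hs).isCycleFace.onFace_iff.2
    ⟨b, by rw [Sym2.eq_swap]; exact mem_boundary_of_adj (hM s hs) hb hab.symm⟩)

/-- The restriction of a perfect matching to `G - S`. -/
def restrict (S : Set D.FiniteFace) (M : G.Subgraph) : (G.induce (D.remaining S)).Subgraph where
  verts := univ
  Adj a b := M.Adj a b
  adj_sub h := M.adj_sub h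
  edge_vert _ := mem_univ _
  symm := ⟨fun _ _ h => h.symm⟩

theorem isPerfectMatching_restrict {M : PerfectMatching G}
    (hM : ∀ s ∈ S, D.IsResonantFace M.1 s) : (restrict S M.1).IsPerfectMatching := by
  rw [SimpleGraph.Subgraph.isPerfectMatching_iff]
  intro v
  obtain ⟨u, hu⟩ := M.exists_adj v
  exact ⟨⟨u, mem_remaining_of_adj hM hu v.2⟩, hu, fun b hb =>
    Subtype.ext (M.2.1.eq_of_adj_left hb hu)⟩

/-- No edge of `M` joins `G - S` to the faces of `S`, so `N` can replace the part of `M` inside `G -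
S`. -/
theorem exists_restrict_eq {M : PerfectMatching G} (hM : ∀ s ∈ S, D.IsResonantFace M.1 s)
    {N : (G.induce (D.remaining S)).Subgraph} (hN : N.IsPerfectMatching) :
    ∃ M' : PerfectMatching G, (∀ s ∈ S, D.IsResonantFace M'.1 s) ∧ restrict S M'.1 = N := by
  let M' : G.Subgraph :=
    { verts := univ
      Adj := fun a b => (a ∉ D.remaining S ∧ b ∉ D.remaining S ∧ M.1.Adj a b) ∨
        ∃ (ha : a ∈ D.remaining S) (hb : b ∈ D.remaining S), N.Adj ⟨a, ha⟩ ⟨b, hb⟩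
      adj_sub := by
        rintro a b (⟨-, -, h⟩ | ⟨ha, hb, h⟩)
        · exact M.1.adj_sub h
        · exact N.adj_sub h
      edge_vert := fun _ => mem_univ _
      symm := ⟨by
        rintro a b (⟨ha, hb, h⟩ | ⟨ha, hb, h⟩)
        · exact Or.inl ⟨hb, ha, h.symm⟩
        · exact Or.inr ⟨hb, ha, h.symm⟩⟩ }
  have hM' : M'.IsPerfectMatching := by
    rw [SimpleGraph.Subgraph.isPerfectMatching_iff]
    intro v
    by_cases hv : v ∈ D.remaining S
    · obtain ⟨u, hu, huniq⟩ := SimpleGraph.Subgraph.isPerfectMatching_iff.1 hN ⟨v, hv⟩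
      refine ⟨u.1, Or.inr ⟨hv, u.2, hu⟩, ?_⟩
      rintro b (⟨h, -, -⟩ | ⟨_, hb, h⟩)
      · exact absurd hv h
      · exact congrArg Subtype.val (huniq ⟨b, hb⟩ h)
    · obtain ⟨u, hu⟩ := M.exists_adj v
      refine ⟨u, Or.inl ⟨hv, fun h => hv (mem_remaining_of_adj hM hu.symm h), hu⟩, ?_⟩
      rintro b (⟨-, -, h⟩ | ⟨h, -, -⟩)
      · exact M.2.1.eq_of_adj_left h hu
      · exact absurd h hv
  refine ⟨⟨M', hM'⟩, fun s hs => ?_, ?_⟩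
  · rw [isResonantFace_iff hM']
    obtain ⟨hc, h⟩ := (isResonantFace_iff M.2).1 (hM s hs)
    refine ⟨hc, fun v hv => ?_⟩
    obtain ⟨u, hu, hus⟩ := h v hv
    have hu' : D.OnFace u s := hc.onFace_iff.2 ⟨v, by rwa [Sym2.eq_swap]⟩
    exact ⟨u, Or.inl ⟨fun hr => hr s hs hv, fun hr => hr s hs hu', hu⟩, hus⟩
  · refine SimpleGraph.Subgraph.ext hN.2.verts_eq_univ.symm ?_
    funext a b
    refine propext ⟨?_, fun h => Or.inr ⟨a.2, b.2, h⟩⟩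
    rintro (⟨h, -, -⟩ | ⟨_, _, h⟩)
    · exact absurd a.2 h
    · exact h

theorem DiffersBy.restrict_eq {M₁ M₂ : PerfectMatching G} {s : D.FiniteFace} (hs : s ∈ S)
    (h : D.DiffersBy M₁ M₂ s) : restrict S M₁.1 = restrict S M₂.1 := by
  obtain ⟨hc, h⟩ := differsBy_iff.1 h
  refine SimpleGraph.Subgraph.ext rfl ?_
  funext a b
  have hab : s(a.1, b.1) ∉ symmDiff M₁.1.edgeSet M₂.1.edgeSet := by
    rw [h]
    exact fun hb => a.2 s hs (hc.onFace_iff.2 ⟨b, hb⟩)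
  rw [mem_symmDiff, SimpleGraph.Subgraph.mem_edgeSet, SimpleGraph.Subgraph.mem_edgeSet] at hab
  change M₁.1.Adj a b = M₂.1.Adj a b
  exact propext (by tauto)

theorem exists_differsBy_of_mem_faceLabels [Finite V] (hG : G.IsBipartite) (hQ : IsHypercube k Q)
    {s : D.FiniteFace} (hs : s ∈ D.faceLabels Q) {M : PerfectMatching G} (hM : M ∈ Q.verts) :
    ∃ M' ∈ Q.verts, D.DiffersBy M M' s := by
  obtain ⟨φ⟩ := hQ
  obtain ⟨l, hl⟩ := exists_isLabelling hG φ
  rw [hl.faceLabels_eq hG] at hs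
  obtain ⟨i, rfl⟩ := hs
  exact ⟨_, (φ.symm (flip i (φ ⟨M, hM⟩))).2, hl.differsBy (a := ⟨M, hM⟩) (by simp)⟩

/-- Inclusion in one direction suffices, because both matchings are perfect. -/
theorem eq_of_boundary_inter_subset {M M' : PerfectMatching G}
    (hM : ∀ s ∈ S, D.IsResonantFace M.1 s) (hrestr : restrict S M.1 = restrict S M'.1)
    (h : ∀ s ∈ S, D.boundary s ∩ M.1.edgeSet ⊆ M'.1.edgeSet) : M = M' := by
  have hadj : ∀ a b, M.1.Adj a b → M'.1.Adj a b := by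
    intro a b hab
    by_cases ha : a ∈ D.remaining S
    · have hb := mem_remaining_of_adj hM hab ha
      have h1 : (restrict S M.1).Adj ⟨a, ha⟩ ⟨b, hb⟩ := hab
      rwa [hrestr] at h1
    · simp only [remaining, mem_ofPred_eq, not_forall, not_not] at ha
      obtain ⟨s, hs, ha⟩ := ha
      exact h s hs ⟨mem_boundary_of_adj (hM s hs) ha hab, hab⟩
  apply PerfectMatching.ext
  ext e
  induction e with
  | _ a b =>
    refine ⟨hadj a b, fun hab => ?_⟩
    obtain ⟨u, hu⟩ := M.exists_adj a
    have hub : u = b := M'.2.1.eq_of_adj_left (hadj a u hu) hab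
    exact hub ▸ hu

/-- After flipping a face on which `M` and `M'` differ, they coincide on its boundary. -/
theorem DiffersBy.boundary_inter_subset {M M₁ M' : PerfectMatching G} {s : D.FiniteFace}
    (h : D.DiffersBy M M₁ s) (hs' : D.IsResonantFace M'.1 s)
    (hne : ¬ D.boundary s ∩ M.1.edgeSet ⊆ M'.1.edgeSet) :
    D.boundary s ∩ M₁.1.edgeSet ⊆ M'.1.edgeSet := by
  obtain ⟨e, ⟨hes, heM⟩, heM'⟩ := not_subset.1 hne
  obtain ⟨hc, hd⟩ := differsBy_iff.1 h
  induction e with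
  | _ a b =>
    have ha : D.OnFace a s := hc.onFace_iff.2 ⟨b, hes⟩
    obtain ⟨x, hx⟩ := M₁.exists_adj a
    obtain ⟨y, hy⟩ := M'.exists_adj a
    have hxs := mem_boundary_of_adj h.symm.isResonantFace ha hx
    have hys := mem_boundary_of_adj hs' ha hy
    have hxb : x ≠ b := by
      rintro rfl
      rw [← hd] at hes
      rcases hes with ⟨-, h⟩ | ⟨-, h⟩
      · exact h hx
      · exact h heM
    have hyb : y ≠ b := by
      rintro rfl
      exact heM' hy
    obtain ⟨z, -, hz⟩ := hc.exists_other hes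
    obtain rfl := ((hz x).1 hxs).resolve_left hxb
    obtain rfl := ((hz y).1 hys).resolve_left hyb
    exact boundary_inter_subset_of_common h.symm.isResonantFace hs' hxs hx hy

/-- Starting from `M`, flip within `Q` a face on which `M` and `M'` disagree, and repeat. On each
periphery there are only two alternating matchings, so each flip repairs its face. -/
theorem mem_verts_of_restrict_eq [Finite V] (hG : G.IsBipartite) (hQ : IsHypercube k Q)
    {M M' : PerfectMatching G} (hM : M ∈ Q.verts)
    (hM' : ∀ s ∈ D.faceLabels Q, D.IsResonantFace M'.1 s)
    (hrestr : restrict (D.faceLabels Q) M.1 = restrict (D.faceLabels Q) M'.1) : M' ∈ Q.verts := by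
  have hS := isResonantSet_faceLabels hG hQ
  have hfin := hS.finite
  induction hn : {s ∈ D.faceLabels Q | ¬ D.boundary s ∩ M.1.edgeSet ⊆ M'.1.edgeSet}.ncard using
    Nat.strong_induction_on generalizing M with
  | _ n ih =>
    by_cases hall : ∀ s ∈ D.faceLabels Q, D.boundary s ∩ M.1.edgeSet ⊆ M'.1.edgeSet
    · rwa [← eq_of_boundary_inter_subset
        (fun s hs => isResonantFace_of_mem_faceLabels hG hQ hs hM) hrestr hall]
    · push Not at hall
      obtain ⟨s, hs, hne⟩ := hall
      obtain ⟨M₁, hM₁, hd⟩ := exists_differsBy_of_mem_faceLabels hG hQ hs hM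
      refine ih _ ?_ hM₁ ((hd.restrict_eq hs).symm.trans hrestr) rfl
      have hcoin := hd.boundary_inter_subset (hM' s hs) hne
      rw [← hn]
      refine ncard_lt_ncard ⟨?_, fun hsub => (hsub ⟨hs, hne⟩).2 hcoin⟩ (hfin.subset (sep_subset _ _))
      -- The flip of `s` does not touch the other, disjoint peripheries, so no new disagreement
      -- arises.
      rintro t ⟨ht, htne⟩
      refine ⟨ht, fun htM => htne ?_⟩
      rintro e ⟨het, heM₁⟩
      by_cases hts : t = s
      · subst hts
        exact hcoin ⟨het, heM₁⟩
      · refine htM ⟨het, ?_⟩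
        by_contra heM
        have hes : e ∈ D.boundary s := by
          rw [← (differsBy_iff.1 hd).2]
          exact Or.inr ⟨heM₁, heM⟩
        have hct := (hM' t ht).isCycleFace
        have hcs := (hM' s hs).isCycleFace
        induction e with
        | _ a b =>
          exact hS.1 t ht s hs hts a ⟨hct.onFace_iff.2 ⟨b, het⟩, hcs.onFace_iff.2 ⟨b, hes⟩⟩

theorem IsCanonical.eq_of_isPerfectMatching (hS : D.IsCanonical S)
    {N N' : (G.induce (D.remaining S)).Subgraph} (hN : N.IsPerfectMatching)
    (hN' : N'.IsPerfectMatching) : N = N' := by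
  rcases hS.2 with h | h
  · have : IsEmpty (D.remaining S) := isEmpty_coe_sort.2 h
    refine SimpleGraph.Subgraph.ext (Subsingleton.elim _ _) ?_
    funext a
    exact isEmptyElim a
  · exact h.unique hN hN'

theorem IsCanonical.hypercube_unique [Finite V] (hG : G.IsBipartite) (hS : D.IsCanonical S)
    {k' : ℕ} {Q' : D.resonanceGraph.Subgraph} (hQ : IsHypercube k Q) (hQ' : IsHypercube k' Q')
    (h : D.faceLabels Q = S) (h' : D.faceLabels Q' = S) : Q = Q' := by
  subst h
  obtain ⟨M, hM⟩ := nonempty_verts hQ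
  obtain ⟨M', hM'⟩ := nonempty_verts hQ'
  have hres : ∀ s ∈ D.faceLabels Q, D.IsResonantFace M.1 s := fun s hs =>
    isResonantFace_of_mem_faceLabels hG hQ hs hM
  have hres' : ∀ s ∈ D.faceLabels Q, D.IsResonantFace M'.1 s := fun s hs =>
    isResonantFace_of_mem_faceLabels hG hQ' (h' ▸ hs) hM'
  exact eq_of_faceLabels_eq hG hQ hQ' h'.symm (mem_verts_of_restrict_eq hG hQ hM hres'
    (hS.eq_of_isPerfectMatching (isPerfectMatching_restrict hres)
      (isPerfectMatching_restrict hres'))) hM'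

theorem restrict_eq_of_mem_verts [Finite V] (hG : G.IsBipartite) (hQ : IsHypercube k Q)
    {M M' : PerfectMatching G} (hM : M ∈ Q.verts) (hM' : M' ∈ Q.verts) :
    restrict (D.faceLabels Q) M.1 = restrict (D.faceLabels Q) M'.1 :=
  isHypercube_induction hG hQ
    (p := fun N => restrict (D.faceLabels Q) M.1 = restrict (D.faceLabels Q) N.1) hM rfl
    (fun _ _ _ hs hd h => h.trans (hd.restrict_eq hs)) hM'

/-- A perfect matching of `G - S` extends to one of `G` keeping `S` resonant, and lies on some
hypercube with labels `S`. By uniqueness this is `Q`, on which the restriction is constant. -/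
theorem isCanonical_of_hypercube_unique [Finite V] (hG : G.IsBipartite) (hQ : IsHypercube k Q)
    (h : D.faceLabels Q = S)
    (huniq : ∀ Q', IsHypercube k Q' → D.faceLabels Q' = S → Q' = Q) : D.IsCanonical S := by
  subst h
  have hS := isResonantSet_faceLabels hG hQ
  obtain ⟨M, hM⟩ := nonempty_verts hQ
  have hres : ∀ s ∈ D.faceLabels Q, D.IsResonantFace M.1 s := fun s hs =>
    isResonantFace_of_mem_faceLabels hG hQ hs hM
  -- The second alternative also covers an empty `G - S`, whose only perfect matching is the empty
  -- one.
  refine ⟨hS, Or.inr ⟨_, isPerfectMatching_restrict hres, fun N hN => ?_⟩⟩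
  obtain ⟨M', hres', rfl⟩ := exists_restrict_eq hres hN
  obtain ⟨Q', hQ', hlab, hM'⟩ := exists_isHypercube hG hS.1 M' hres' (encard_faceLabels hG hQ)
  rw [huniq Q' hQ' hlab] at hM'
  exact restrict_eq_of_mem_verts hG hQ hM' hM

end PlaneDrawing

end PlaneResonance

/-! ### Assembly of the three statements. -/

theorem lemmaL {V : Type*} [Finite V] (G : SimpleGraph V) (hbip : G.IsBipartite)
    (D : PlaneResonance.PlaneDrawing G)
    (hpm : ∃ M : G.Subgraph, M.IsPerfectMatching)
    (hK2 : ¬ Nonempty (G ≃g (⊤ : SimpleGraph (Fin 2)))) :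
    -- every Θ-class of a hypercube of `R(G)` has a unique face-label
    (∀ (k : ℕ) (Q : D.resonanceGraph.Subgraph), 1 ≤ k → PlaneResonance.IsHypercube k Q →
      ∀ c, PlaneResonance.IsThetaClass Q.coe c → ∃! s, D.IsFaceLabel Q c s) ∧
    -- `f` sends every hypercube to the set of face-labels of its Θ-classes
    ∃ f : D.Hypercubes → D.ResonantSets,
      (∀ Q, (f Q).1 = D.faceLabels Q.1) ∧
      (∀ (k : ℕ) (Q : D.Hypercubes), PlaneResonance.IsHypercube k Q.1 →
        (f Q).1.encard = k ∧
        ∀ S : D.ResonantSets, S.1.encard = k →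
          (∀ s ∈ S.1, ∃ c, PlaneResonance.IsThetaClass Q.1.coe c ∧ D.IsFaceLabel Q.1 c s) →
          S = f Q) ∧
      Function.Surjective f ∧
      ∀ (k : ℕ) (S : D.ResonantSets), 1 ≤ k → S.1.encard = k →
        ((∃ Q : D.Hypercubes, PlaneResonance.IsHypercube k Q.1 ∧ f ⁻¹' {S} = {Q}) ↔
          D.IsCanonical S.1) := by
  have hf : ∀ Q : D.Hypercubes, (D.faceLabels Q.1).Nonempty ∧ D.IsResonantSet (D.faceLabels Q.1) := by
    rintro ⟨Q, k, hk, hQ⟩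
    refine ⟨?_, PlaneResonance.PlaneDrawing.isResonantSet_faceLabels hbip hQ⟩
    rw [← Set.encard_pos, PlaneResonance.PlaneDrawing.encard_faceLabels hbip hQ]
    exact_mod_cast hk
  have hcube : ∀ (k : ℕ) (S : D.ResonantSets), S.1.encard = k →
      ∃ Q : D.Hypercubes, PlaneResonance.IsHypercube k Q.1 ∧ D.faceLabels Q.1 = S.1 := by
    rintro k ⟨S, hne, hdis, M, hM, hres⟩ hk
    obtain ⟨Q, hQ, hlab, -⟩ :=
      PlaneResonance.PlaneDrawing.exists_isHypercube hbip hdis ⟨M, hM⟩ hres hk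
    rw [← Set.encard_pos, hk] at hne
    exact ⟨⟨Q, k, by exact_mod_cast hne, hQ⟩, hQ, hlab⟩
  refine ⟨fun k Q _ hQ c hc => PlaneResonance.PlaneDrawing.existsUnique_isFaceLabel hbip hQ hc,
    fun Q => ⟨D.faceLabels Q.1, hf Q⟩, fun Q => rfl, fun k Q hQ => ?_, fun S => ?_,
    fun k S hk hS => ?_⟩
  · have hcard := PlaneResonance.PlaneDrawing.encard_faceLabels hbip hQ
    refine ⟨hcard, fun S hS hsub => Subtype.ext ?_⟩
    refine Set.Finite.eq_of_subset_of_encard_le (Set.finite_of_encard_eq_coe hS) hsub ?_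
    rw [hS, hcard]
  · obtain ⟨Q, -, hQ⟩ := hcube S.1.ncard S (S.2.2.finite.cast_ncard_eq).symm
    exact ⟨Q, Subtype.ext hQ⟩
  · constructor
    · rintro ⟨Q, hQ, hfib⟩
      have hQS : Q ∈ ({Q} : Set D.Hypercubes) := rfl
      rw [← hfib] at hQS
      have hlab : D.faceLabels Q.1 = S.1 := congrArg Subtype.val hQS
      refine PlaneResonance.PlaneDrawing.isCanonical_of_hypercube_unique hbip hQ hlab
        fun Q' hQ' hlab' => ?_
      have hmem : (⟨Q', k, hk, hQ'⟩ : D.Hypercubes) ∈ ({Q} : Set D.Hypercubes) := by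
        rw [← hfib]
        exact Subtype.ext hlab'
      exact congrArg Subtype.val hmem
    · intro hcan
      obtain ⟨Q, hQ, hlab⟩ := hcube k S hS
      refine ⟨Q, hQ, Set.Subset.antisymm (fun Q' hQ' => ?_) ?_⟩
      -- The dimension of another hypercube in the fiber is not assumed to be `k`; the uniqueness
      -- lemma allows for this.
      · obtain ⟨k', -, hQc'⟩ := Q'.2
        exact Subtype.ext (hcan.hypercube_unique hbip hQc' hQ (congrArg Subtype.val hQ') hlab)
      · rintro _ rfl
        exact Subtype.ext hlab
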